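/- Let $n\ge 3$ and $q\in\{3,4\}$, let $V$ be an $n$-dimensional vector space over $\mathbb{F}_{q^2}$ with a non-degenerate hermitian form $h$, let $SU(V,h)$ be the group of linear isometries of $h$ of determinant $1$, and let $\mathrm{PSU}_n(q)$ be its quotient by the scalar transformations it contains. A $1$-space $\langle v\rangle$ (with $v\ne 0$) is called nonsingular if $h(v,v)\neq 0$ and singular if $h(v,v)=0$. Let $NU_n(q)$ be the graph whose vertices are the nonsingular $1$-spaces of $V$, two distinct ones $P,Q$ being adjacent if and only if the projective line through them is a tangent, that is, the $2$-space $P+Q$ contains exactly one singular $1$-space. Let $G$ be a primitive permutation group of rank $4$ on a finite set $\Omega$ (so $G$ has exactly four orbits, called orbitals, on $\Omega\times\Omega$). Suppose that its socle $S$ (the subgroup generated by the minimal normal subgroups of $G$) is isomorphic to $\mathrm{PSU}_n(q)$, and that, under some isomorphism $S\cong \mathrm{PSU}_n(q)$, the stabiliser $S_\alpha$ of some point $\alpha\in\Omega$ corresponds to the stabiliser $N_1$ in $\mathrm{PSU}_n(q)$ of a nonsingular $1$-space $P$. For a non-diagonal orbital $\Delta$ of $G$, with reversed orbital $\Delta^*$,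 the associated orbital graph has vertex set $\Omega$ and edge set $\Delta\cup\Delta^*$. A finite graph is strongly regular if it is regular, any two adjacent vertices have the same number $\lambda$ of common neighbours, and any two distinct non-adjacent vertices have the same number $\mu$ of common neighbours. Then $\Omega$ can be identified with the set of nonsingular $1$-spaces of $V$, with $\alpha$ corresponding to $P$ and the action of $S$ on $\Omega$ corresponding to the action of $\mathrm{PSU}_n(q)$, in such a way that $NU_n(q)$ is an orbital graph of $G$ associated to a non-diagonal orbital, is strongly regular, and is the only strongly regular graph among the orbital graphs of $G$ associated to non-diagonal orbitals. -/

import Mathlib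

open scoped Pointwise

namespace UnitarySRG

/-! ### Permutation groups: socle, rank, orbital graphs -/

/-- `N` is a minimal normal subgroup of `G`. -/
def IsMinimalNormal {G : Type*} [Group G] (N : Subgroup G) : Prop :=
  N.Normal ∧ N ≠ ⊥ ∧ ∀ M : Subgroup G, M.Normal → M ≤ N → M = ⊥ ∨ M = N

/-- The socle of `G`: the subgroup generated by all minimal normal subgroups. -/
def socle (G : Type*) [Group G] : Subgroup G :=
  sSup {N : Subgroup G | IsMinimalNormal N}

/-- The rank of an action: the number of orbits of `G` on `Ω × Ω`. -/
noncomputable def permRank (G Ω : Type*) [Group G] [MulAction G Ω] : ℕ :=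
  Nat.card (MulAction.orbitRel.Quotient G (Ω × Ω))

/-- The orbital graph of a set `Δ` of pairs: distinct `x`, `y` are joined iff
`(x, y) ∈ Δ ∪ Δ*`, where `Δ*` is the set of reversed pairs. -/
def orbitalGraph {Ω : Type*} (Δ : Set (Ω × Ω)) : SimpleGraph Ω :=
  SimpleGraph.fromRel fun x y => (x, y) ∈ Δ

/-- `Γ` is the orbital graph of a non-diagonal orbital of `G` on `Ω`, that is, of the `G`-orbit
of some pair `(x, y)` with `x ≠ y`. -/
def IsOrbitalGraph (G : Type*) {Ω : Type*} [Group G] [MulAction G Ω] (Γ : SimpleGraph Ω) : Prop :=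
  ∃ x y : Ω, x ≠ y ∧ Γ = orbitalGraph (MulAction.orbit G (x, y))

open scoped Classical in
/-- `Γ` is strongly regular, for some parameters `(v, k, l, m)`. -/
def IsStronglyRegular {Ω : Type*} [Fintype Ω] (Γ : SimpleGraph Ω) : Prop :=
  ∃ v k l m : ℕ, Γ.IsSRGWith v k l m

/-! ### Hermitian spaces, `SU`, `PSU`, nonsingular points, and the graph `NU` -/

section Hermitian

variable {F V : Type*} [Field F] [AddCommGroup V] [Module F V] {σ : F →+* F}

/-- The special unitary group of the form `h`: linear automorphisms of determinant one that
preserve `h`. -/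
def SU (h : V →ₛₗ[σ] V →ₗ[F] F) : Subgroup (V ≃ₗ[F] V) where
  carrier := {g | (∀ x y, h (g x) (g y) = h x y) ∧ LinearEquiv.det g = 1}
  mul_mem' := by
    rintro a b ⟨ha, ha'⟩ ⟨hb, hb'⟩
    refine ⟨fun x y => ?_, by rw [map_mul, ha', hb', one_mul]⟩
    rw [LinearEquiv.mul_apply, LinearEquiv.mul_apply, ha, hb]
  one_mem' := ⟨fun _ _ => rfl, map_one _⟩
  inv_mem' := by
    rintro a ⟨ha, ha'⟩
    refine ⟨fun x y => ?_, by rw [map_inv, ha', inv_one]⟩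
    have e : ∀ z, a (a⁻¹ z) = z := fun z => a.apply_symm_apply z
    rw [← ha, e, e]

/-- The scalar transformations in `SU h`. -/
def scalars (h : V →ₛₗ[σ] V →ₗ[F] F) : Subgroup (SU h) where
  carrier := {g | ∃ c : F, ∀ v : V, g.1 v = c • v}
  mul_mem' := by
    rintro a b ⟨c, hc⟩ ⟨d, hd⟩
    exact ⟨c * d, fun v => by
      rw [Subgroup.coe_mul, LinearEquiv.mul_apply, hd, hc, mul_smul]⟩
  one_mem' := ⟨1, fun v => by simp⟩
  inv_mem' := by
    rintro a ⟨c, hc⟩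
    have e : ∀ z, a.1 (a.1⁻¹ z) = z := fun z => a.1.apply_symm_apply z
    refine ⟨c⁻¹, fun v => ?_⟩
    rw [Subgroup.coe_inv]
    rcases eq_or_ne c 0 with rfl | h0
    · have hz : ∀ z : V, z = 0 := fun z => by rw [← e z, hc, zero_smul]
      rw [hz (_ • v), hz (a.1⁻¹ v)]
    · rw [eq_inv_smul_iff₀ h0, ← hc, e]

instance scalars_normal (h : V →ₛₗ[σ] V →ₗ[F] F) : (scalars h).Normal where
  conj_mem := by
    rintro a ⟨c, hc⟩ g
    have e : ∀ z, g.1 (g.1⁻¹ z) = z := fun z => g.1.apply_symm_apply z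
    refine ⟨c, fun v => ?_⟩
    rw [Subgroup.coe_mul, Subgroup.coe_mul, Subgroup.coe_inv, LinearEquiv.mul_apply,
      LinearEquiv.mul_apply, hc, map_smul, e]

/-- The projective special unitary group: `SU h` modulo its scalars. -/
abbrev PSU (h : V →ₛₗ[σ] V →ₗ[F] F) : Type _ := SU h ⧸ scalars h

/-- The nonsingular `1`-spaces `⟨v⟩`, `h(v, v) ≠ 0`, of `V`. -/
def NonsingularPoint (h : V →ₛₗ[σ] V →ₗ[F] F) : Type _ :=
  {P : Submodule F V // ∃ v : V, h v v ≠ 0 ∧ P = F ∙ v}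

/-- The points `⟨v⟩`, `v ≠ 0`, `h(v, v) = 0`, of the hermitian variety. -/
def IsSingularPoint (h : V →ₛₗ[σ] V →ₗ[F] F) (P : Submodule F V) : Prop :=
  ∃ v : V, v ≠ 0 ∧ h v v = 0 ∧ P = F ∙ v

/-- `SU h` acts on the nonsingular `1`-spaces by taking images. -/
instance (h : V →ₛₗ[σ] V →ₗ[F] F) : MulAction (SU h) (NonsingularPoint h) where
  smul g P := ⟨P.1.map g.1.toLinearMap, by
    obtain ⟨v, hv, hP⟩ := P.2
    refine ⟨g.1 v, by rw [g.2.1]; exact hv, ?_⟩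
    rw [hP, Submodule.map_span, Set.image_singleton]; rfl⟩
  one_smul P := Subtype.ext (Submodule.map_id P.1)
  mul_smul a b P := Subtype.ext (Submodule.map_comp b.1.toLinearMap a.1.toLinearMap P.1)

/-- The subgroup `N_1` of `PSU h`: the stabiliser of the nonsingular `1`-space `P`. -/
def N1 (h : V →ₛₗ[σ] V →ₗ[F] F) (P : NonsingularPoint h) : Subgroup (PSU h) :=
  (MulAction.stabilizer (SU h) P).map (QuotientGroup.mk' (scalars h))

/-- The nonisotropic unitary graph: two distinct nonsingular `1`-spaces are joined iff the
projective line through them is a tangent, i.e. contains exactly one singular point. -/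
def NU (h : V →ₛₗ[σ] V →ₗ[F] F) : SimpleGraph (NonsingularPoint h) where
  Adj P Q := P ≠ Q ∧ ∃! R : Submodule F V, IsSingularPoint h R ∧ R ≤ P.1 ⊔ Q.1
  symm := by
    constructor
    rintro P Q ⟨hne, hR⟩
    exact ⟨hne.symm, by rwa [sup_comm]⟩
  loopless := ⟨fun P hP => hP.1 rfl⟩

end Hermitian

end UnitarySRG

/-! Write N(a) = a * σ a. Every nonsingular point is spanned by a unit vector, unique up to the q +
1 scalars of norm one, so N(h(v, w)), for unit vectors v and w, is an invariant of a pair of points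
with values in the fixed field of σ. Value 1 on distinct points means that the plane is degenerate,
that is, the line is a tangent; value 0 means orthogonality.

Orbits. A Witt-type argument on orthonormal families (`IsUnitary.exists_SU_map_eq_smul`) puts a pair
of distinct points into a normal form depending only on its invariant, so SU is transitive on such
pairs with a given invariant. The suborbits with values 1, 0 and "anything else" have three
different sizes. As the socle is normal, G permutes its suborbits and preserves their sizes, hence
preserves the four types of pairs: equal, tangent, orthogonal, other. All four occur and the rank is
4, so the types are exactly the orbitals. For q = 4 the two remaining values have suborbits of equal
size, and it is the rank hypothesis that fuses them.

Strong regularity. All counts come from `IsUnitary.card_coords`, the number of vectors of given norm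
with given coordinates on an orthonormal family. For the tangent relation, λ is constant because
adjacent pairs form one SU-orbit. Further, μ is constant because the number of points tangent to
both P and Q is the same for every invariant of (P, Q) other than 1 (`IsUnitary.card_common_one`).
For the orthogonality relation, tangent and other pairs have different numbers of common neighbours;
for the remaining relation, tangent and orthogonal pairs do. So neither is strongly regular. -/

namespace UnitarySRG

open Finset
open scoped Classical

/-! ### Norm and trace of a quadratic extension of finite fields -/

section Field

/-- If the fibres of `f : s → t` have at most `m` elements, `t` has at most `l`, and `s` has
`m * l`, then every fibre has exactly `m` elements. -/
theorem card_fiber_eq_of_le {A B : Type*} {s : Finset A} {t : Finset B} {f : A → B} {m l : ℕ}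
    (hs : m * l ≤ #s) (ht : #t ≤ l) (hf : ∀ a ∈ s, f a ∈ t)
    (hm : ∀ b ∈ t, #{a ∈ s | f a = b} ≤ m) : ∀ b ∈ t, #{a ∈ s | f a = b} = m := by
  by_contra! hcon
  obtain ⟨b, hb, hne⟩ := hcon
  have h1 := card_eq_sum_card_fiberwise (f := f) (s := s) (t := t) hf
  have h2 : ∑ b ∈ t, #{a ∈ s | f a = b} < ∑ _b ∈ t, m :=
    sum_lt_sum hm ⟨b, hb, lt_of_le_of_ne (hm b hb) hne⟩
  rw [sum_const, smul_eq_mul, mul_comm] at h2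
  have := Nat.mul_le_mul_left m ht
  omega

/-- `F` has `q²` elements and `σ` is its `q`-power map. -/
structure IsQuadraticFrobenius {F : Type*} [Field F] (q : ℕ) (σ : F →+* F) : Prop where
  one_lt : 1 < q
  card_eq : Nat.card F = q ^ 2
  apply_eq : ∀ a, σ a = a ^ q

variable {F : Type*} [Field F] [Fintype F] {q : ℕ} {σ : F →+* F}

namespace IsQuadraticFrobenius

theorem apply_apply (H : IsQuadraticFrobenius q σ) (a : F) : σ (σ a) = a := by
  rw [H.apply_eq, H.apply_eq, ← pow_mul, ← sq, ← H.card_eq, Nat.card_eq_fintype_card,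
    FiniteField.pow_card]

theorem apply_mul_self (H : IsQuadraticFrobenius q σ) (a : F) : σ (a * σ a) = a * σ a := by
  rw [map_mul, H.apply_apply, mul_comm]

theorem apply_add_self (H : IsQuadraticFrobenius q σ) (a : F) : σ (a + σ a) = a + σ a := by
  rw [map_add, H.apply_apply, add_comm]

theorem card_univ (H : IsQuadraticFrobenius q σ) : Fintype.card F = q ^ 2 := by
  rw [← Nat.card_eq_fintype_card, H.card_eq]

/-- Pigeonhole: the q² - 1 nonzero elements map into the roots of X^(q-1) - 1, at most q - 1 of
them, and each fibre consists of roots of X^(q+1) - b. Both bounds must therefore be attained. -/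
theorem card_norm_fiber (H : IsQuadraticFrobenius q σ) {t : F} (ht : σ t = t) (h0 : t ≠ 0) :
    #{a : F | a * σ a = t} = q + 1 := by
  have hq := H.one_lt
  have key := card_fiber_eq_of_le (s := univ.filter fun a : F => a ≠ 0)
    (t := univ.filter fun b : F => b ≠ 0 ∧ σ b = b) (f := fun a => a * σ a)
    (m := q + 1) (l := q - 1) ?_ ?_ ?_ ?_ t (by simp [ht, h0])
  · rw [← key, filter_filter]
    congr 1
    ext a
    simp only [mem_filter, mem_univ, true_and]
    refine ⟨fun h => ⟨?_, h⟩, fun h => h.2⟩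
    rintro rfl
    exact h0 (by simpa using h.symm)
  · rw [filter_ne' univ (0 : F), card_erase_of_mem (mem_univ _), Finset.card_univ, H.card_univ]
    obtain ⟨p, rfl⟩ : ∃ p, q = p + 1 := ⟨q - 1, by omega⟩
    apply le_of_eq
    simp only [Nat.add_sub_cancel]
    apply Nat.eq_sub_of_add_eq
    ring
  · refine le_trans (card_le_card (t := (Polynomial.nthRoots (q - 1) (1 : F)).toFinset) ?_)
      (le_trans (Multiset.toFinset_card_le _) (Polynomial.card_nthRoots _ _))
    intro b hb
    simp only [mem_filter, mem_univ, true_and] at hb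
    rw [Multiset.mem_toFinset, Polynomial.mem_nthRoots (by omega)]
    have h1 : b ^ (q - 1) * b = 1 * b := by
      rw [← pow_succ, Nat.sub_add_cancel hq.le, ← H.apply_eq, hb.2, one_mul]
    exact mul_right_cancel₀ hb.1 h1
  · intro a ha
    simp only [mem_filter, mem_univ, true_and] at ha ⊢
    exact ⟨mul_ne_zero ha (by simpa using ha), H.apply_mul_self a⟩
  · intro b _
    refine le_trans (card_le_card (t := (Polynomial.nthRoots (q + 1) b).toFinset) ?_)
      (le_trans (Multiset.toFinset_card_le _) (Polynomial.card_nthRoots _ _))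
    intro a ha
    simp only [mem_filter, mem_univ, true_and] at ha
    rw [Multiset.mem_toFinset, Polynomial.mem_nthRoots (by omega), pow_succ, ← H.apply_eq,
      mul_comm, ha.2]

/-- The same pigeonhole argument: traces are roots of X^q - X, and each fibre consists of roots of
X^q + X - b, while the field has q * q elements. -/
theorem card_trace_fiber (H : IsQuadraticFrobenius q σ) {t : F} (ht : σ t = t) :
    #{a : F | a + σ a = t} = q := by
  have hq := H.one_lt
  have root_bound : ∀ (e : ℕ) (c d : F) (s : Finset F), 1 < e →
      (∀ a ∈ s, a ^ e + c * a = d) → #s ≤ e := by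
    intro e c d s he hs
    have hdeg : (Polynomial.C c * Polynomial.X - Polynomial.C d : Polynomial F).degree
        < (e : WithBot ℕ) := by
      refine lt_of_le_of_lt (Polynomial.degree_sub_le _ _) (max_lt ?_ ?_)
      · refine lt_of_le_of_lt (Polynomial.degree_C_mul_X_le c) (by exact_mod_cast he)
      · refine lt_of_le_of_lt Polynomial.degree_C_le (by exact_mod_cast (by omega : 0 < e))
    have hmon := Polynomial.monic_X_pow_add hdeg
    refine le_trans (Polynomial.card_le_degree_of_subset_roots (p := Polynomial.X ^ e +
      (Polynomial.C c * Polynomial.X - Polynomial.C d)) ?_) (by compute_degree; omega)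
    intro a ha
    rw [Polynomial.mem_roots hmon.ne_zero, Polynomial.IsRoot.def]
    simp [← hs a ha]
  have key := card_fiber_eq_of_le (s := (univ : Finset F))
    (t := univ.filter fun b : F => σ b = b) (f := fun a => a + σ a)
    (m := q) (l := q) ?_ ?_ ?_ ?_ t (by simp [ht])
  · exact key
  · rw [Finset.card_univ, H.card_univ, sq]
  · refine root_bound q (-1) 0 _ hq fun a ha => ?_
    simp only [mem_filter, mem_univ, true_and, H.apply_eq] at ha
    rw [ha]; ring
  · intro a _
    simpa using H.apply_add_self a
  · intro b _
    refine root_bound q 1 b _ hq fun a ha => ?_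
    simp only [mem_filter, mem_univ, true_and, H.apply_eq] at ha
    rw [← ha]; ring

theorem exists_norm_eq (H : IsQuadraticFrobenius q σ) {t : F} (ht : σ t = t) :
    ∃ a, a * σ a = t := by
  rcases eq_or_ne t 0 with rfl | h0
  · exact ⟨0, by simp⟩
  · have h1 := H.card_norm_fiber ht h0
    obtain ⟨a, ha⟩ := card_pos.1 (by rw [h1]; omega)
    exact ⟨a, by simpa using ha⟩

theorem exists_trace_eq (H : IsQuadraticFrobenius q σ) {t : F} (ht : σ t = t) :
    ∃ a, a + σ a = t := by
  have h1 := H.card_trace_fiber ht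
  have := H.one_lt
  obtain ⟨a, ha⟩ := card_pos.1 (by rw [h1]; omega)
  exact ⟨a, by simpa using ha⟩

/-- The number of elements of norm `t`. -/
theorem card_norm (H : IsQuadraticFrobenius q σ) {t : F} (ht : σ t = t) :
    #{a : F | a * σ a = t} = if t = 0 then 1 else q + 1 := by
  split_ifs with h0
  · subst h0
    rw [card_eq_one]
    exact ⟨0, by ext; simp⟩
  · exact H.card_norm_fiber ht h0

/-- The number of elements whose norm is neither `0` nor `1`. -/
theorem card_norm_ne (H : IsQuadraticFrobenius q σ) :
    #{a : F | a * σ a ≠ 0 ∧ a * σ a ≠ 1} = (q - 2) * (q + 1) := by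
  have h0 := H.card_norm (map_zero σ)
  have h1 := H.card_norm (map_one σ)
  rw [if_pos rfl] at h0
  rw [if_neg one_ne_zero] at h1
  have h2 := card_filter_add_card_filter_not (s := (univ : Finset F)) (fun a => a * σ a = 0)
  have h3 := card_filter_add_card_filter_not (s := (univ.filter fun a : F => ¬ a * σ a = 0))
    (fun a => a * σ a = 1)
  rw [filter_filter, filter_filter] at h3
  have h4 : (univ.filter fun a : F => ¬ a * σ a = 0 ∧ a * σ a = 1)
      = univ.filter fun a : F => a * σ a = 1 := by
    ext a
    simp only [mem_filter, mem_univ, true_and, and_iff_right_iff_imp]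
    intro h
    rw [h]
    exact one_ne_zero
  rw [h4, h1] at h3
  rw [h0, Finset.card_univ, H.card_univ] at h2
  obtain ⟨p, rfl⟩ : ∃ p, q = p + 2 := ⟨q - 2, by have := H.one_lt; omega⟩
  have h5 : #{a : F | a * σ a ≠ 0 ∧ a * σ a ≠ 1} + (p + 2 + 1) + 1 = (p + 2) ^ 2 := by
    simp only [ne_eq]
    omega
  simp only [Nat.add_sub_cancel]
  nlinarith

end IsQuadraticFrobenius

end Field

/-! ### Orthonormal families and the basic vector count -/

section Orthonormal

variable {F V : Type*} [Field F] [AddCommGroup V] [Module F V] {σ : F →+* F}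

/-- `h` is a nondegenerate hermitian form over the field with `q²` elements. -/
structure IsUnitary (q : ℕ) (h : V →ₛₗ[σ] V →ₗ[F] F) : Prop where
  frob : IsQuadraticFrobenius q σ
  symm : h.IsSymm
  nondeg : h.Nondegenerate

/-- The family `f` is orthonormal for `h`. -/
def IsOrthonormal (h : V →ₛₗ[σ] V →ₗ[F] F) {k : ℕ} (f : Fin k → V) : Prop :=
  ∀ i j, h (f i) (f j) = if i = j then 1 else 0

variable {h : V →ₛₗ[σ] V →ₗ[F] F} {q k : ℕ}

theorem IsUnitary.conj (H : IsUnitary q h) (x y : V) : σ (h x y) = h y x := H.symm.eq x y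

theorem form_smul_left (a : F) (x y : V) : h (a • x) y = σ a * h x y := by
  rw [map_smulₛₗ, LinearMap.smul_apply, smul_eq_mul]

theorem form_smul_right (a : F) (x y : V) : h x (a • y) = a * h x y := by
  rw [map_smul, smul_eq_mul]

theorem form_sum_right {ι : Type*} (s : Finset ι) (c : ι → F) (f : ι → V) (x : V) :
    h x (∑ i ∈ s, c i • f i) = ∑ i ∈ s, c i * h x (f i) := by
  simp [map_sum]

theorem IsOrthonormal.form_sum {f : Fin k → V} (hf : IsOrthonormal h f) (c : Fin k → F)
    (i : Fin k) : h (f i) (∑ j, c j • f j) = c i := by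
  rw [form_sum_right]
  simp [hf i]

theorem IsOrthonormal.form_sum_sum {f : Fin k → V} (hf : IsOrthonormal h f) (c d : Fin k → F) :
    h (∑ j, c j • f j) (∑ j, d j • f j) = ∑ j, σ (c j) * d j := by
  rw [map_sum h, LinearMap.sum_apply]
  refine sum_congr rfl fun j _ => ?_
  rw [form_smul_left, hf.form_sum]

theorem IsOrthonormal.linearIndependent {f : Fin k → V} (hf : IsOrthonormal h f) :
    LinearIndependent F f := by
  rw [Fintype.linearIndependent_iff]
  intro c hc i
  rw [← hf.form_sum c i, hc, map_zero]

theorem IsOrthonormal.cons {f : Fin k → V} (hf : IsOrthonormal h f) (H : IsUnitary q h) {e : V}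
    (he : h e e = 1) (hfe : ∀ i, h (f i) e = 0) :
    IsOrthonormal h (Fin.cons e f : Fin (k + 1) → V) := by
  intro i j
  refine Fin.cases ?_ (fun i => ?_) i <;> refine Fin.cases ?_ (fun j => ?_) j
  · simpa using he
  · simp only [Fin.cons_zero, Fin.cons_succ]
    rw [← H.conj, hfe, map_zero, if_neg (Fin.succ_ne_zero j).symm]
  · simp [hfe]
  · simpa using hf i j

/-- A full orthonormal family as a basis. -/
noncomputable def IsOrthonormal.basis {f : Fin k → V} (hf : IsOrthonormal h f)
    (hk : k = Module.finrank F V) (h0 : 0 < k) : Module.Basis (Fin k) F V :=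
  haveI : Nonempty (Fin k) := ⟨⟨0, h0⟩⟩
  basisOfLinearIndependentOfCardEqFinrank hf.linearIndependent (by simpa using hk)

theorem IsOrthonormal.basis_apply {f : Fin k → V} (hf : IsOrthonormal h f)
    (hk : k = Module.finrank F V) (h0 : 0 < k) (i : Fin k) : hf.basis hk h0 i = f i := by
  simp [IsOrthonormal.basis]

theorem IsOrthonormal.sum_eq {f : Fin k → V} (hf : IsOrthonormal h f)
    (hk : k = Module.finrank F V) (h0 : 0 < k) (x : V) : ∑ i, h (f i) x • f i = x := by
  have hx := (hf.basis hk h0).sum_repr x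
  simp only [hf.basis_apply] at hx
  conv_rhs => rw [← hx]
  refine sum_congr rfl fun i _ => ?_
  conv_lhs => rw [← hx, hf.form_sum]

theorem IsUnitary.form_add_smul (H : IsUnitary q h) (x y : V) (a : F) :
    h (x + a • y) (x + a • y)
      = h x x + (a * h x y + σ (a * h x y)) + a * σ a * h y y := by
  simp only [map_add, LinearMap.add_apply, form_smul_left, form_smul_right, map_mul, H.conj]
  ring

variable [Fintype F]

theorem IsUnitary.exists_smul_norm_one (H : IsUnitary q h) {x : V} (hx : h x x ≠ 0) :
    ∃ a : F, a ≠ 0 ∧ h (a • x) (a • x) = 1 := by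
  obtain ⟨a, ha⟩ := H.frob.exists_norm_eq (H.conj x x)
  have ha0 : a ≠ 0 := by rintro rfl; simp at ha; exact hx ha.symm
  refine ⟨a⁻¹, inv_ne_zero ha0, ?_⟩
  have h1 : σ a ≠ 0 := by simpa using ha0
  rw [form_smul_left, form_smul_right, ← ha, map_inv₀]
  field_simp

/-- An orthonormal family that is not full can be extended. -/
theorem IsUnitary.exists_orthogonal_norm_one [FiniteDimensional F V] (H : IsUnitary q h)
    {f : Fin k → V} (hf : IsOrthonormal h f) (hk : k < Module.finrank F V) :
    ∃ e, h e e = 1 ∧ ∀ i, h (f i) e = 0 := by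
  suffices hu : ∃ u, h u u ≠ 0 ∧ ∀ i, h (f i) u = 0 by
    obtain ⟨u, hu, hfu⟩ := hu
    obtain ⟨a, -, ha⟩ := H.exists_smul_norm_one hu
    exact ⟨a • u, ha, fun i => by rw [form_smul_right, hfu, mul_zero]⟩
  -- It suffices to find a vector of nonzero norm in the orthogonal complement. Take z ≠ 0 there and
  -- some y not orthogonal to z; removing the components of y along the family gives y' in the
  -- complement with `h z y' ≠ 0`.
  have hker : LinearMap.ker (LinearMap.pi fun i => h (f i)) ≠ ⊥ :=
    LinearMap.ker_ne_bot_of_finrank_lt (by simpa using hk)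
  obtain ⟨z, hz, hz0⟩ := (Submodule.ne_bot_iff _).1 hker
  replace hz : ∀ i, h (f i) z = 0 := fun i => congr_fun (LinearMap.mem_ker.1 hz) i
  obtain ⟨y, hy⟩ : ∃ y, h z y ≠ 0 := by
    by_contra! hc
    exact hz0 (H.nondeg.1 z hc)
  obtain ⟨y', hy', hfy'⟩ : ∃ y', h z y' ≠ 0 ∧ ∀ i, h (f i) y' = 0 := by
    refine ⟨y - ∑ i, h (f i) y • f i, ?_, fun i => ?_⟩
    · rw [map_sub, form_sum_right, sum_eq_zero, sub_zero]
      · exact hy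
      · intro i _
        rw [← H.conj (f i) z, hz, map_zero, mul_zero]
    · rw [map_sub, hf.form_sum, sub_self]
  by_contra! hcon
  have h1 : h z z = 0 := by
    by_contra hc
    obtain ⟨i, hi⟩ := hcon z hc
    exact hi (hz i)
  have h2 : h y' y' = 0 := by
    by_contra hc
    obtain ⟨i, hi⟩ := hcon y' hc
    exact hi (hfy' i)
  -- If z and y' are both isotropic, the vector below has norm τ + σ τ = 1.
  obtain ⟨τ, hτ⟩ := H.frob.exists_trace_eq (map_one σ)
  obtain ⟨i, hi⟩ := hcon (z + (τ / h z y') • y') (by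
    rw [H.form_add_smul, h1, h2, div_mul_cancel₀ _ hy', hτ]
    simp)
  exact hi (by rw [map_add, form_smul_right, hz, hfy']; simp)

/-- The number of vectors of norm `t` with prescribed coordinates on an orthonormal family with
`d` vectors missing from a basis. -/
theorem IsUnitary.card_coords [FiniteDimensional F V] [Fintype V] (H : IsUnitary q h) (d : ℕ) :
    ∀ {k : ℕ} {f : Fin k → V}, 0 < k → IsOrthonormal h f → k + d = Module.finrank F V →
    ∀ (a : Fin k → F) (t : F), σ t = t →
      (q : ℤ) * #{z : V | (∀ i, h (f i) z = a i) ∧ h z z = t}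
        = q ^ (2 * d) + (-q) ^ d * (if t = ∑ i, a i * σ (a i) then (q : ℤ) - 1 else -1) := by
  induction d with
  | zero =>
    intro k f h0 hf hk a t _
    have hnorm : h (∑ i, a i • f i) (∑ i, a i • f i) = ∑ i, a i * σ (a i) := by
      rw [hf.form_sum_sum]
      exact sum_congr rfl fun i _ => mul_comm _ _
    have huniq : ∀ z, (∀ i, h (f i) z = a i) → z = ∑ i, a i • f i := by
      intro z hz
      rw [← hf.sum_eq hk h0 z]
      simp only [hz]
    split_ifs with ht
    · have : (univ.filter fun z : V => (∀ i, h (f i) z = a i) ∧ h z z = t)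
          = {∑ i, a i • f i} := by
        ext z
        simp only [mem_filter, mem_univ, true_and, mem_singleton]
        refine ⟨fun hz => huniq z hz.1, ?_⟩
        rintro rfl
        exact ⟨hf.form_sum a, by rw [hnorm, ht]⟩
      rw [this, card_singleton]
      simp
    · have : (univ.filter fun z : V => (∀ i, h (f i) z = a i) ∧ h z z = t) = ∅ := by
        rw [filter_eq_empty_iff]
        rintro z - ⟨hz, hzt⟩
        rw [huniq z hz, hnorm] at hzt
        exact ht hzt.symm
      rw [this, card_empty]
      simp
  | succ d ih =>
    intro k f h0 hf hk a t ht
    obtain ⟨e, he, hfe⟩ := H.exists_orthogonal_norm_one hf (by omega)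
    have hf' := hf.cons H he hfe
    have hsum := card_eq_sum_card_fiberwise (f := fun z => h e z)
      (s := univ.filter fun z : V => (∀ i, h (f i) z = a i) ∧ h z z = t) (t := univ)
      (fun _ _ => mem_coe.2 (mem_univ _))
    -- Split by the coordinate b on a new unit vector e. The value `q - 1` or `-1` of the induction
    -- hypothesis is written as `q` or `0` plus the constant `-1`; the `q` occurs for the b with
    -- N(b) = t - ∑ N(a i), of which there are 1 or q + 1.
    have hfib : ∀ b : F, (q : ℤ) * #{z ∈ univ.filter fun z : V =>
        (∀ i, h (f i) z = a i) ∧ h z z = t | h e z = b}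
        = q ^ (2 * d) + (-q) ^ d *
          (if b * σ b = t - ∑ i, a i * σ (a i) then (q : ℤ) else 0) + (-q) ^ d * (-1) := by
      intro b
      have := ih (Nat.succ_pos k) hf' (by omega) (Fin.cons b a) t ht
      simp only [Fin.forall_fin_succ, Fin.cons_zero, Fin.cons_succ, Fin.sum_univ_succ] at this
      rw [filter_filter]
      have hset : (univ.filter fun z : V => ((∀ i, h (f i) z = a i) ∧ h z z = t) ∧ h e z = b)
          = univ.filter fun z : V => (h e z = b ∧ ∀ i, h (f i) z = a i) ∧ h z z = t := by
        ext z; simp only [mem_filter, mem_univ, true_and]; tauto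
      have hiff : (t = b * σ b + ∑ i, a i * σ (a i))
          ↔ b * σ b = t - ∑ i, a i * σ (a i) := by
        rw [eq_sub_iff_add_eq, eq_comm]
      rw [hset, this]
      simp only [hiff]
      split_ifs <;> ring
    have hfix : σ (t - ∑ i, a i * σ (a i)) = t - ∑ i, a i * σ (a i) := by
      rw [map_sub, ht, map_sum]
      simp only [H.frob.apply_mul_self]
    rw [hsum, Nat.cast_sum, mul_sum]
    simp only [hfib, sum_add_distrib, ← mul_sum, sum_const, Finset.card_univ, H.frob.card_univ,
      ← sum_filter, H.frob.card_norm hfix, sub_eq_zero (b := ∑ i, a i * σ (a i)), nsmul_eq_mul]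
    split_ifs <;> push_cast <;> ring

end Orthonormal

/-! ### Witt-type extension by elements of SU -/

section Isometry

variable {F V : Type*} [Field F] [AddCommGroup V] [Module F V] {σ : F →+* F}
variable {h : V →ₛₗ[σ] V →ₗ[F] F} {q k : ℕ}

/-- Two full orthonormal families are matched by an isometry. -/
theorem IsOrthonormal.exists_isometry {f f' : Fin k → V} (hf : IsOrthonormal h f)
    (hf' : IsOrthonormal h f') (hk : k = Module.finrank F V) (h0 : 0 < k) :
    ∃ g : V ≃ₗ[F] V, (∀ x y, h (g x) (g y) = h x y) ∧ ∀ i, g (f i) = f' i := by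
  have hg : ∀ i, (hf.basis hk h0).equiv (hf'.basis hk h0) (Equiv.refl _) (f i) = f' i := by
    intro i
    rw [← hf.basis_apply hk h0, Module.Basis.equiv_apply, Equiv.refl_apply, hf'.basis_apply]
  refine ⟨(hf.basis hk h0).equiv (hf'.basis hk h0) (Equiv.refl _), fun x y => ?_, hg⟩
  set g := (hf.basis hk h0).equiv (hf'.basis hk h0) (Equiv.refl _)
  rw [← hf.sum_eq hk h0 x, ← hf.sum_eq hk h0 y, map_sum g, map_sum g]
  simp only [map_smul g, hg]
  rw [hf.form_sum_sum, hf'.form_sum_sum]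

/-- The determinant of an isometry has norm one. -/
theorem IsOrthonormal.det_norm_eq_one {f : Fin k → V}
    (hf : IsOrthonormal h f)
    (hk : k = Module.finrank F V) (h0 : 0 < k) {g : V →ₗ[F] V}
    (hg : ∀ x y, h (g x) (g y) = h x y) : LinearMap.det g * σ (LinearMap.det g) = 1 := by
  set b := hf.basis hk h0 with hb
  set M : Matrix (Fin k) (Fin k) F := LinearMap.toMatrix b b g with hM
  have hMij : ∀ i j, M i j = h (f i) (g (f j)) := by
    intro i j
    rw [hM, LinearMap.toMatrix_apply, hb, hf.basis_apply]
    have := hf.form_sum (fun i => (hf.basis hk h0).repr (g (f j)) i) i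
    rw [← this]
    congr 1
    have h2 := (hf.basis hk h0).sum_repr (g (f j))
    simp only [hf.basis_apply] at h2
    exact h2
  -- The product is the Gram matrix of the images of the orthonormal basis, which is again the
  -- identity.
  have hmul : (σ.mapMatrix M).transpose * M = 1 := by
    ext i j
    rw [Matrix.mul_apply, Matrix.one_apply, ← hf i j, ← hg (f i) (f j)]
    conv_rhs => rw [← hf.sum_eq hk h0 (g (f i)), ← hf.sum_eq hk h0 (g (f j)), hf.form_sum_sum]
    exact sum_congr rfl fun l _ => by
      rw [Matrix.transpose_apply, RingHom.mapMatrix_apply, Matrix.map_apply, hMij, hMij]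
  have hdet := congrArg Matrix.det hmul
  rw [Matrix.det_mul, Matrix.det_transpose, ← RingHom.map_det, Matrix.det_one, hM,
    LinearMap.det_toMatrix] at hdet
  rw [mul_comm, hdet]

variable [Fintype F]

/-- Orthonormal families of the same size that are not full are matched by an element of `SU`. -/
theorem IsUnitary.exists_SU_map_eq [FiniteDimensional F V] (H : IsUnitary q h) (d : ℕ) :
    ∀ {k : ℕ} {f f' : Fin k → V}, IsOrthonormal h f → IsOrthonormal h f' →
      k + d + 1 = Module.finrank F V → ∃ g ∈ SU h, ∀ i, g (f i) = f' i := by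
  induction d with
  | zero =>
    intro k f f' hf hf' hk
    obtain ⟨e, he, hfe⟩ := H.exists_orthogonal_norm_one hf (by omega)
    obtain ⟨e', he', hfe'⟩ := H.exists_orthogonal_norm_one hf' (by omega)
    have hc := hf.cons H he hfe
    have hc' := hf'.cons H he' hfe'
    obtain ⟨g₀, hg₀, hmap₀⟩ := hc.exists_isometry hc' hk (Nat.succ_pos k)
    set δ := LinearMap.det (g₀ : V →ₗ[F] V) with hδ
    have hN : δ * σ δ = 1 := hc.det_norm_eq_one hk (Nat.succ_pos k) (g := g₀) hg₀
    have hδ0 : δ ≠ 0 := left_ne_zero_of_mul_eq_one hN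
    have hσδ0 : σ δ ≠ 0 := right_ne_zero_of_mul_eq_one hN
    -- One basis vector remains free. Since δ has norm one, its image e' may be replaced by δ⁻¹ •
    -- e', which is still a unit vector; by multilinearity this divides the determinant by δ.
    have he'' : h (δ⁻¹ • e') (δ⁻¹ • e') = 1 := by
      rw [form_smul_left, form_smul_right, he', map_inv₀, mul_one, ← mul_inv, mul_comm, hN,
        inv_one]
    have hc'' := hf'.cons H he'' (fun i => by rw [form_smul_right, hfe', mul_zero])
    obtain ⟨g, hg, hmap⟩ := hc.exists_isometry hc'' hk (Nat.succ_pos k)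
    refine ⟨g, ⟨hg, ?_⟩, fun i => by simpa using hmap i.succ⟩
    apply Units.ext
    rw [LinearEquiv.coe_det, Units.val_one]
    have hdet := fun T : V →ₗ[F] V => (hc.basis hk (Nat.succ_pos k)).det_comp T
      (hc.basis hk (Nat.succ_pos k))
    simp only [Module.Basis.det_self, mul_one] at hdet
    have e1 : (g : V →ₗ[F] V) ∘ (hc.basis hk (Nat.succ_pos k)) = Function.update
        ((g₀ : V →ₗ[F] V) ∘ (hc.basis hk (Nat.succ_pos k))) 0 (δ⁻¹ • e') := by
      ext i
      refine Fin.cases ?_ (fun i => ?_) i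
      · simpa [hc.basis_apply] using hmap 0
      · have h1 := hmap i.succ
        have h2 := hmap₀ i.succ
        simp only [Fin.cons_succ] at h1 h2
        simp [hc.basis_apply, h1, h2]
    have e2 : Function.update ((g₀ : V →ₗ[F] V) ∘ (hc.basis hk (Nat.succ_pos k))) 0 e'
        = (g₀ : V →ₗ[F] V) ∘ (hc.basis hk (Nat.succ_pos k)) := by
      rw [Function.update_eq_self_iff]
      simpa [hc.basis_apply] using (hmap₀ 0).symm
    rw [← hdet g, e1, AlternatingMap.map_update_smul, e2, hdet, smul_eq_mul, ← hδ,
      inv_mul_cancel₀ hδ0]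
  | succ d ih =>
    intro k f f' hf hf' hk
    obtain ⟨e, he, hfe⟩ := H.exists_orthogonal_norm_one hf (by omega)
    obtain ⟨e', he', hfe'⟩ := H.exists_orthogonal_norm_one hf' (by omega)
    obtain ⟨g, hg, hmap⟩ := ih (hf.cons H he hfe) (hf'.cons H he' hfe') (by omega)
    exact ⟨g, hg, fun i => by simpa using hmap i.succ⟩

/-- Orthonormal triples are matched, up to a common scalar, by an element of `SU`. -/
theorem IsUnitary.exists_SU_map_eq_smul [FiniteDimensional F V] (H : IsUnitary q h)
    (hq : q = 3 ∨ q = 4) (hn : 3 ≤ Module.finrank F V) {f f' : Fin 3 → V}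
    (hf : IsOrthonormal h f) (hf' : IsOrthonormal h f') :
    ∃ g ∈ SU h, ∃ a : F, a ≠ 0 ∧ ∀ i, g (f i) = a • f' i := by
  rcases hn.eq_or_lt with hn | hn
  · obtain ⟨g, hg, hmap⟩ := hf.exists_isometry hf' hn (by norm_num)
    set δ := LinearMap.det (g : V →ₗ[F] V) with hδ
    have hN : δ * σ δ = 1 := hf.det_norm_eq_one hn (by norm_num) (g := g) hg
    -- In dimension 3 no vector is free, so the determinant is corrected by a scalar, which needs a
    -- cube root of δ⁻¹ of norm one. It exists because δ^(q+1) = 1 and 3 is prime to q + 1, which is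
    -- 4 or 5.
    obtain ⟨a, ha, haN⟩ : ∃ a, a ^ 3 * δ = 1 ∧ a * σ a = 1 := by
      have hpow : δ ^ (q + 1) = 1 := by rw [pow_succ, ← H.frob.apply_eq, mul_comm, hN]
      rcases hq with rfl | rfl
      · exact ⟨δ, by rw [← pow_succ, hpow], hN⟩
      · refine ⟨δ ^ 3, ?_, by rw [map_pow, ← mul_pow, hN, one_pow]⟩
        calc (δ ^ 3) ^ 3 * δ = (δ ^ (4 + 1)) ^ 2 := by ring
          _ = 1 := by rw [hpow, one_pow]
    have ha0 : a ≠ 0 := left_ne_zero_of_mul_eq_one haN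
    refine ⟨g.trans (LinearEquiv.smulOfNeZero F V a ha0), ⟨fun x y => ?_, ?_⟩, a, ha0,
      fun i => ?_⟩
    · simp only [LinearEquiv.trans_apply, LinearEquiv.smulOfNeZero_apply, form_smul_left,
        form_smul_right, hg]
      rw [← mul_assoc, haN, one_mul]
    · apply Units.ext
      rw [LinearEquiv.coe_det, Units.val_one]
      have : ((g.trans (LinearEquiv.smulOfNeZero F V a ha0) : V ≃ₗ[F] V) : V →ₗ[F] V)
          = a • (g : V →ₗ[F] V) := by ext; simp
      rw [this, LinearMap.det_smul, ← hn, ← hδ, ha]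
    · simp [hmap]
  · obtain ⟨g, hg, hmap⟩ := H.exists_SU_map_eq (Module.finrank F V - 4) hf hf' (by omega)
    exact ⟨g, hg, 1, one_ne_zero, fun i => by rw [hmap, one_smul]⟩

end Isometry

/-! ### Normal forms for pairs of unit vectors -/

section Pairs

variable {F V : Type*} [Field F] [AddCommGroup V] [Module F V] {σ : F →+* F}
variable {h : V →ₛₗ[σ] V →ₗ[F] F} {q : ℕ}

theorem isOrthonormal_singleton {v : V} (hv : h v v = 1) : IsOrthonormal h ![v] := by
  intro i j
  rw [Subsingleton.elim i 0, Subsingleton.elim j 0]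
  simpa using hv

theorem IsUnitary.isOrthonormal_pair (H : IsUnitary q h) {e v : V} (hv : h v v = 1)
    (he : h e e = 1) (hve : h v e = 0) : IsOrthonormal h ![e, v] :=
  (isOrthonormal_singleton hv).cons H he (fun i => by rw [Subsingleton.elim i 0]; simpa using hve)

/-- Unit vectors spanning a nondegenerate plane, in terms of an orthonormal basis of it. -/
theorem IsUnitary.exists_orthonormal_of_ne (H : IsUnitary q h) {v w : V} (hv : h v v = 1)
    (hw : h w w = 1) {c : F} (hc : c ≠ 0) (hcN : c * σ c = 1 - h v w * σ (h v w)) :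
    ∃ e, IsOrthonormal h ![e, v] ∧ w = h v w • v + c • e := by
  have hve : h v (c⁻¹ • (w + (-h v w) • v)) = 0 := by
    rw [form_smul_right, map_add, form_smul_right, hv]
    ring
  have hσc : σ c ≠ 0 := by simpa using hc
  refine ⟨c⁻¹ • (w + (-h v w) • v), H.isOrthonormal_pair hv ?_ hve, ?_⟩
  · rw [form_smul_left, form_smul_right, H.form_add_smul, hv, hw, ← H.conj v w, map_inv₀]
    simp only [map_mul, map_neg, H.conj] at hcN ⊢
    field_simp
    linear_combination -hcN
  · rw [smul_inv_smul₀ hc, neg_smul]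
    abel

variable [Fintype F]

/-- Unit vectors on a tangent, in terms of an orthonormal triple. -/
theorem IsUnitary.exists_orthonormal_of_tangent (H : IsUnitary q h) {v w : V} (hv : h v v = 1)
    (hw : h w w = 1) (hvw : h v w = 1) (hne : v ≠ w) {c : F} (hcN : c * σ c = -1) :
    ∃ e₁ e₂, IsOrthonormal h ![e₁, e₂, v] ∧ w = v + e₂ + c • e₁ := by
  have hwv : h w v = 1 := by rw [← H.conj, hvw, map_one]
  -- The isotropic vector r is orthogonal to v. It is completed to a unit vector e orthogonal to v
  -- with h(e, r) = 1. Then r - e is orthogonal to e and v and has norm -1, so dividing it by c, of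
  -- norm -1, gives a unit vector.
  set r := w - v with hr
  have hr0 : r ≠ 0 := sub_ne_zero.2 hne.symm
  have hvr : h v r = 0 := by rw [hr, map_sub, hvw, hv, sub_self]
  have hrv : h r v = 0 := by rw [← H.conj, hvr, map_zero]
  have hrr : h r r = 0 := by simp [hr, map_sub, LinearMap.sub_apply, hvw, hv, hw, hwv]
  obtain ⟨y, hy⟩ : ∃ y, h y r ≠ 0 := by
    by_contra! hcon
    exact hr0 (H.nondeg.2 r hcon)
  have hσy : σ (h y r) ≠ 0 := by simpa using hy
  obtain ⟨y₁, hy₁r, hvy₁⟩ : ∃ y₁, h y₁ r = 1 ∧ h v y₁ = 0 := by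
    refine ⟨(σ (h y r))⁻¹ • (y + (-h v y) • v), ?_, ?_⟩
    · rw [form_smul_left, map_add, LinearMap.add_apply, form_smul_left, hvr, map_inv₀,
        H.frob.apply_apply]
      field_simp
      ring
    · rw [form_smul_right, map_add, form_smul_right, hv]
      ring
  obtain ⟨τ, hτ⟩ := H.frob.exists_trace_eq (t := 1 - h y₁ y₁)
    (by rw [map_sub, map_one, H.conj])
  set e := y₁ + τ • r with he
  have hee : h e e = 1 := by
    rw [he, H.form_add_smul, hrr, hy₁r, mul_one, hτ]
    ring
  have hve : h v e = 0 := by rw [he, map_add, form_smul_right, hvy₁, hvr]; ring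
  have her : h e r = 1 := by
    rw [he, map_add, LinearMap.add_apply, form_smul_left, hy₁r, hrr]; ring
  have hre : h r e = 1 := by rw [← H.conj, her, map_one]
  have hc0 : c ≠ 0 := by
    rintro rfl
    simp at hcN
  have hσc : σ c ≠ 0 := by simpa using hc0
  refine ⟨c⁻¹ • (r + (-1 : F) • e), e, ?_, ?_⟩
  · refine (H.isOrthonormal_pair hv hee hve).cons H ?_ ?_
    · rw [form_smul_left, form_smul_right, H.form_add_smul, hrr, hre, hee, map_inv₀]
      simp only [map_neg, map_one, mul_one]
      field_simp
      rw [mul_comm, hcN]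
      ring
    · intro i
      fin_cases i
      · simp [her, hee]
      · simp [hvr, hve]
  · rw [smul_inv_smul₀ hc0, neg_smul, one_smul, hr]
    abel

/-- Unit vectors are matched, up to a scalar, by an element of `SU`. -/
theorem IsUnitary.exists_SU_vector [FiniteDimensional F V] (H : IsUnitary q h)
    (hq : q = 3 ∨ q = 4) (hn : 3 ≤ Module.finrank F V) {v v' : V} (hv : h v v = 1)
    (hv' : h v' v' = 1) : ∃ g ∈ SU h, ∃ a : F, a ≠ 0 ∧ g v = a • v' := by
  have ext : ∀ v : V, h v v = 1 → ∃ e₁ e₂, IsOrthonormal h ![e₁, e₂, v] := by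
    intro v hv
    obtain ⟨e₂, he₂, hve₂⟩ := H.exists_orthogonal_norm_one (isOrthonormal_singleton hv) (by omega)
    have h2 := (isOrthonormal_singleton hv).cons H he₂ hve₂
    obtain ⟨e₁, he₁, hve₁⟩ := H.exists_orthogonal_norm_one h2 (by omega)
    exact ⟨e₁, e₂, h2.cons H he₁ hve₁⟩
  obtain ⟨e₁, e₂, hf⟩ := ext v hv
  obtain ⟨e₁', e₂', hf'⟩ := ext v' hv'
  obtain ⟨g, hg, a, ha, hmap⟩ := H.exists_SU_map_eq_smul hq hn hf hf'
  exact ⟨g, hg, a, ha, hmap 2⟩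

/-- Pairs of distinct unit vectors with the same inner product are matched, up to a scalar, by an
element of `SU`. -/
theorem IsUnitary.exists_SU_pair [FiniteDimensional F V] (H : IsUnitary q h)
    (hq : q = 3 ∨ q = 4) (hn : 3 ≤ Module.finrank F V) {v w v' w' : V} (hv : h v v = 1)
    (hw : h w w = 1) (hv' : h v' v' = 1) (hw' : h w' w' = 1) (heq : h v w = h v' w')
    (hone : h v w * σ (h v w) = 1 → h v w = 1 ∧ v ≠ w ∧ v' ≠ w') :
    ∃ g ∈ SU h, ∃ a : F, a ≠ 0 ∧ g v = a • v' ∧ g w = a • w' := by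
  -- Norm one is the degenerate plane, where the normal form needs a triple; otherwise v and w lie
  -- in the span of an orthonormal pair, which is completed to a triple. The coefficients in either
  -- form depend only on h(v, w) and on a common choice of c.
  by_cases h1 : h v w * σ (h v w) = 1
  · obtain ⟨hx, hne, hne'⟩ := hone h1
    obtain ⟨c, hc⟩ := H.frob.exists_norm_eq (t := -1) (by rw [map_neg, map_one])
    obtain ⟨e₁, e₂, hf, hwe⟩ := H.exists_orthonormal_of_tangent hv hw hx hne hc
    obtain ⟨e₁', e₂', hf', hwe'⟩ :=
      H.exists_orthonormal_of_tangent hv' hw' (by rw [← heq, hx]) hne' hc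
    obtain ⟨g, hg, a, ha, hmap⟩ := H.exists_SU_map_eq_smul hq hn hf hf'
    have m0 : g e₁ = a • e₁' := hmap 0
    have m1 : g e₂ = a • e₂' := hmap 1
    have m2 : g v = a • v' := hmap 2
    refine ⟨g, hg, a, ha, m2, ?_⟩
    rw [hwe, hwe', map_add, map_add, map_smul, m0, m1, m2, smul_add, smul_add, smul_comm]
  · obtain ⟨c, hc⟩ := H.frob.exists_norm_eq (t := 1 - h v w * σ (h v w))
      (by rw [map_sub, map_one, H.frob.apply_mul_self])
    have hc0 : c ≠ 0 := by
      rintro rfl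
      apply h1
      rw [zero_mul] at hc
      exact (sub_eq_zero.1 hc.symm).symm
    obtain ⟨e₂, hf, hwe⟩ := H.exists_orthonormal_of_ne hv hw hc0 hc
    obtain ⟨e₂', hf', hwe'⟩ := H.exists_orthonormal_of_ne hv' hw' hc0 (by rw [hc, heq])
    obtain ⟨e₁, he₁, hfe₁⟩ := H.exists_orthogonal_norm_one hf (by omega)
    obtain ⟨e₁', he₁', hfe₁'⟩ := H.exists_orthogonal_norm_one hf' (by omega)
    obtain ⟨g, hg, a, ha, hmap⟩ :=
      H.exists_SU_map_eq_smul hq hn (hf.cons H he₁ hfe₁) (hf'.cons H he₁' hfe₁')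
    have m1 : g e₂ = a • e₂' := hmap 1
    have m2 : g v = a • v' := hmap 2
    refine ⟨g, hg, a, ha, m2, ?_⟩
    rw [hwe, hwe', map_add, map_smul, map_smul, m1, m2, heq, smul_add, smul_comm, smul_comm c a]

/-! ### Counting unit vectors with given inner products -/

theorem IsQuadraticFrobenius.card_trace_mul (H : IsQuadraticFrobenius q σ) {b t : F}
    (hb : b ≠ 0) (ht : σ t = t) : #{a : F | b * a + σ (b * a) = t} = q := by
  rw [← H.card_trace_fiber ht]
  refine card_bij (fun a _ => b * a) (fun a ha => by simpa using ha)
    (fun a _ a' _ haa => mul_left_cancel₀ hb haa) fun a ha => ⟨b⁻¹ * a, ?_, ?_⟩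
  · rw [mem_filter, mul_inv_cancel_left₀ hb]
    simpa using ha
  · exact mul_inv_cancel_left₀ hb a

variable [Fintype V] [FiniteDimensional F V]

theorem IsUnitary.card_vector (H : IsUnitary q h) {d : ℕ} (hn : Module.finrank F V = d + 1)
    {v : V} (hv : h v v = 1) (a : F) {t : F} (ht : σ t = t) :
    (q : ℤ) * #{z : V | h v z = a ∧ h z z = t}
      = q ^ (2 * d) + (-q) ^ d * (if t = a * σ a then (q : ℤ) - 1 else -1) := by
  have := H.card_coords d Nat.one_pos (isOrthonormal_singleton hv) (by omega) (fun _ => a) t ht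
  simpa using this

/-- With w = x v + c e, prescribing the products with v and w prescribes the coordinates on the
orthonormal pair e, v. The condition in the formula is that of `IsUnitary.card_coords` multiplied by
N(c) = 1 - N(x). -/
theorem IsUnitary.card_pair_of_ne (H : IsUnitary q h) {d : ℕ} (hn : Module.finrank F V = d + 2)
    {v w : V} (hv : h v v = 1) (hw : h w w = 1) (hne : h v w * σ (h v w) ≠ 1) (a b : F)
    {t : F} (ht : σ t = t) :
    (q : ℤ) * #{z : V | h v z = a ∧ h w z = b ∧ h z z = t}
      = q ^ (2 * d) + (-q) ^ d *
        (if (t - a * σ a) * (1 - h v w * σ (h v w))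
          = (b - σ (h v w) * a) * σ (b - σ (h v w) * a) then (q : ℤ) - 1 else -1) := by
  obtain ⟨c, hc⟩ := H.frob.exists_norm_eq (t := 1 - h v w * σ (h v w))
    (by rw [map_sub, map_one, H.frob.apply_mul_self])
  have hc0 : c ≠ 0 := by
    rintro rfl
    rw [zero_mul] at hc
    exact hne (sub_eq_zero.1 hc.symm).symm
  have hσc : σ c ≠ 0 := by simpa using hc0
  obtain ⟨e, hf, hwe⟩ := H.exists_orthonormal_of_ne hv hw hc0 hc
  set x := h v w with hx
  have key := H.card_coords d Nat.two_pos hf (by omega) ![(b - σ x * a) / σ c, a] t ht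
  have hset : (univ.filter fun z : V => h v z = a ∧ h w z = b ∧ h z z = t)
      = univ.filter fun z : V => (∀ i, h (![e, v] i) z = ![(b - σ x * a) / σ c, a] i)
        ∧ h z z = t := by
    ext z
    have hwz : h w z = σ x * h v z + σ c * h e z := by
      conv_lhs => rw [hwe]
      rw [map_add, LinearMap.add_apply, form_smul_left, form_smul_left]
    simp only [mem_filter, mem_univ, true_and, Fin.forall_fin_two, hwz, eq_div_iff hσc,
      Matrix.cons_val_zero, Matrix.cons_val_one]
    constructor
    · rintro ⟨rfl, rfl, ht⟩
      exact ⟨⟨by ring, rfl⟩, ht⟩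
    · rintro ⟨⟨h1, rfl⟩, ht⟩
      exact ⟨rfl, by rw [mul_comm (σ c), h1]; ring, ht⟩
  rw [hset, key]
  have hiff : (t = ∑ i, ![(b - σ x * a) / σ c, a] i * σ (![(b - σ x * a) / σ c, a] i))
      ↔ (t - a * σ a) * (1 - x * σ x) = (b - σ x * a) * σ (b - σ x * a) := by
    rw [Fin.sum_univ_two, ← hc]
    simp only [Matrix.cons_val_zero, Matrix.cons_val_one, map_div₀, H.frob.apply_apply]
    rw [← sub_eq_iff_eq_add, div_mul_div_comm, eq_div_iff (mul_ne_zero hσc hc0), mul_comm (σ c)]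
  simp only [hiff]

/-- With w = v + e₂ + c e₁, the coordinate y on e₁ is free and the one on e₂ is then b - a - σ(c) y.
As N(c) = -1, the terms N(y) cancel and the norm condition is a trace equation in y. It has q
solutions if a ≠ b; if a = b it does not involve y. -/
theorem IsUnitary.card_pair_of_tangent (H : IsUnitary q h) {d : ℕ}
    (hn : Module.finrank F V = d + 3) {v w : V} (hv : h v v = 1) (hw : h w w = 1)
    (hvw : h v w = 1) (hne : v ≠ w) (a b : F) {t : F} (ht : σ t = t) :
    (q : ℤ) * #{z : V | h v z = a ∧ h w z = b ∧ h z z = t}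
      = if a = b then
          q ^ 2 * (q ^ (2 * d) + (-q) ^ d * (if t = a * σ a then (q : ℤ) - 1 else -1))
        else (q : ℤ) ^ (2 * d + 2) := by
  obtain ⟨c, hc⟩ := H.frob.exists_norm_eq (t := -1) (by rw [map_neg, map_one])
  have hc0 : c ≠ 0 := by rintro rfl; simp at hc
  obtain ⟨e₁, e₂, hf, hwe⟩ := H.exists_orthonormal_of_tangent hv hw hvw hne hc
  have hsum := card_eq_sum_card_fiberwise (f := fun z => h e₁ z)
    (s := univ.filter fun z : V => h v z = a ∧ h w z = b ∧ h z z = t) (t := univ)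
    (fun _ _ => mem_coe.2 (mem_univ _))
  have hfib : ∀ y : F, (q : ℤ) * #{z ∈ univ.filter fun z : V =>
      h v z = a ∧ h w z = b ∧ h z z = t | h e₁ z = y}
      = q ^ (2 * d) + (-q) ^ d *
        (if σ (b - a) * σ c * y + σ (σ (b - a) * σ c * y)
          = (b - a) * σ (b - a) + a * σ a - t then (q : ℤ) else 0) + (-q) ^ d * (-1) := by
    intro y
    have key := H.card_coords d (by norm_num) hf (by omega) ![y, b - a - σ c * y, a] t ht
    have hset : (univ.filter fun z : V => (h v z = a ∧ h w z = b ∧ h z z = t) ∧ h e₁ z = y)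
        = univ.filter fun z : V => (∀ i, h (![e₁, e₂, v] i) z = ![y, b - a - σ c * y, a] i)
          ∧ h z z = t := by
      ext z
      have hwz : h w z = h v z + h e₂ z + σ c * h e₁ z := by
        rw [hwe]
        rw [map_add, map_add, LinearMap.add_apply, LinearMap.add_apply, form_smul_left]
      simp only [mem_filter, mem_univ, true_and, Fin.forall_fin_succ, hwz,
        Matrix.cons_val_zero, Matrix.cons_val_succ, IsEmpty.forall_iff, and_true]
      constructor
      · rintro ⟨⟨rfl, rfl, ht⟩, rfl⟩
        exact ⟨⟨rfl, by ring, rfl⟩, ht⟩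
      · rintro ⟨⟨rfl, h1, rfl⟩, ht⟩
        exact ⟨⟨rfl, by rw [h1]; ring, ht⟩, rfl⟩
    have hiff : (t = ∑ i, ![y, b - a - σ c * y, a] i * σ (![y, b - a - σ c * y, a] i))
        ↔ σ (b - a) * σ c * y + σ (σ (b - a) * σ c * y)
          = (b - a) * σ (b - a) + a * σ a - t := by
      rw [Fin.sum_univ_three]
      simp only [Matrix.cons_val_zero, Matrix.cons_val_one, Matrix.cons_val, map_sub, map_mul,
        H.frob.apply_apply]
      constructor <;> intro h1
      · linear_combination h1 + (y * σ y) * hc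
      · linear_combination h1 - (y * σ y) * hc
    rw [filter_filter, hset, key]
    simp only [hiff]
    split_ifs <;> ring
  have hfix : σ ((b - a) * σ (b - a) + a * σ a - t) = (b - a) * σ (b - a) + a * σ a - t := by
    rw [map_sub, map_add, H.frob.apply_mul_self, H.frob.apply_mul_self, ht]
  rw [hsum, Nat.cast_sum, mul_sum]
  simp only [hfib]
  rw [sum_add_distrib, sum_add_distrib, sum_const, sum_const, Finset.card_univ, H.frob.card_univ,
    ← mul_sum, ← sum_filter]
  by_cases hab : a = b
  · subst hab
    simp only [sub_self, map_zero, zero_mul, zero_add, if_pos]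
    have : (0 = a * σ a - t) ↔ t = a * σ a := by rw [eq_comm, sub_eq_zero, eq_comm]
    simp only [this]
    split_ifs with h1
    · rw [filter_true_of_mem fun _ _ => h1, sum_const, Finset.card_univ, H.frob.card_univ]
      simp only [nsmul_eq_mul]
      push_cast
      ring
    · rw [filter_false_of_mem fun _ _ => h1, sum_empty]
      simp only [nsmul_eq_mul]
      push_cast
      ring
  · have hba : σ (b - a) * σ c ≠ 0 :=
      mul_ne_zero ((map_ne_zero σ).2 (sub_ne_zero.2 (Ne.symm hab))) ((map_ne_zero σ).2 hc0)
    rw [if_neg hab, sum_const, H.frob.card_trace_mul hba hfix]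
    simp only [nsmul_eq_mul]
    push_cast
    ring

end Pairs

/-! ### Counts of unit vectors by the norms of two inner products -/

section Sums

variable {F V : Type*} [Field F] [AddCommGroup V] [Module F V] {σ : F →+* F}
variable {h : V →ₛₗ[σ] V →ₗ[F] F} {q : ℕ} [Fintype F] [Fintype V]

theorem card_eq_sum_card_coord (v : V) (p : F → Prop) [DecidablePred p] :
    #{z : V | h z z = 1 ∧ p (h v z)} = ∑ a : F with p a, #{z : V | h v z = a ∧ h z z = 1} := by
  rw [card_eq_sum_card_fiberwise (f := fun z => h v z) (t := univ.filter p)]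
  · refine sum_congr rfl fun a ha => ?_
    rw [filter_filter]
    congr 1
    ext z
    simp only [mem_filter, mem_univ, true_and] at ha ⊢
    constructor
    · rintro ⟨⟨h1, -⟩, h2⟩
      exact ⟨h2, h1⟩
    · rintro ⟨rfl, h1⟩
      exact ⟨⟨h1, ha⟩, rfl⟩
  · intro z hz
    simpa using (mem_filter.1 hz).2.2

theorem card_eq_sum_card_coords (v w : V) (p r : F → Prop) [DecidablePred p]
    [DecidablePred r] :
    #{z : V | h z z = 1 ∧ p (h v z) ∧ r (h w z)}
      = ∑ a : F with p a, ∑ b : F with r b, #{z : V | h v z = a ∧ h w z = b ∧ h z z = 1} := by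
  rw [← sum_product', card_eq_sum_card_fiberwise (f := fun z => (h v z, h w z))
    (t := univ.filter p ×ˢ univ.filter r)]
  · refine sum_congr rfl fun a ha => ?_
    rw [filter_filter]
    congr 1
    ext z
    simp only [mem_product, mem_filter, mem_univ, true_and, Prod.ext_iff] at ha ⊢
    constructor
    · rintro ⟨⟨h1, -, -⟩, h2, h3⟩
      exact ⟨h2, h3, h1⟩
    · rintro ⟨h2, h3, h1⟩
      rw [h2, h3]
      exact ⟨⟨h1, ha⟩, rfl, rfl⟩
  · intro z hz
    simpa using (mem_filter.1 hz).2.2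

variable [FiniteDimensional F V]

theorem IsUnitary.card_norm_form_eq (H : IsUnitary q h) {d : ℕ}
    (hn : Module.finrank F V = d + 1) {v : V} (hv : h v v = 1) {c : F} (hc : σ c = c) :
    (q : ℤ) * #{z : V | h z z = 1 ∧ h v z * σ (h v z) = c}
      = (if c = 0 then 1 else (q : ℤ) + 1) *
        (q ^ (2 * d) + (-q) ^ d * (if c = 1 then (q : ℤ) - 1 else -1)) := by
  rw [card_eq_sum_card_coord v fun a => a * σ a = c, Nat.cast_sum, mul_sum]
  simp only [H.card_vector hn hv _ (map_one σ)]
  rw [sum_congr rfl (g := fun _ => (q : ℤ) ^ (2 * d) + (-q) ^ d *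
    (if c = 1 then (q : ℤ) - 1 else -1)), sum_const, H.frob.card_norm hc, nsmul_eq_mul]
  · push_cast
    rfl
  · intro a ha
    rw [(mem_filter.1 ha).2]
    simp only [eq_comm]

/-- Unit vectors having inner products of norm one with two unit vectors of a nondegenerate
plane. -/
theorem IsUnitary.card_norm_one_of_ne (H : IsUnitary q h) {d : ℕ}
    (hn : Module.finrank F V = d + 2) {v w : V} (hv : h v v = 1) (hw : h w w = 1)
    (hne : h v w * σ (h v w) ≠ 1) :
    (q : ℤ) * #{z : V | h z z = 1 ∧ h v z * σ (h v z) = 1 ∧ h w z * σ (h w z) = 1}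
      = ((q : ℤ) + 1) ^ 2 * (q ^ (2 * d) - (-q) ^ d) := by
  rw [card_eq_sum_card_coords v w (fun a => a * σ a = 1) (fun b => b * σ b = 1)]
  push_cast
  rw [mul_sum]
  simp only [mul_sum, H.card_pair_of_ne hn hv hw hne _ _ (map_one σ)]
  have hone := H.frob.card_norm (map_one σ)
  rw [if_neg one_ne_zero] at hone
  rw [sum_congr rfl (g := fun _ => ((q : ℤ) + 1) * (q ^ (2 * d) - (-q) ^ d)), sum_const, hone,
    nsmul_eq_mul]
  · push_cast
    ring
  · intro a ha
    replace ha := (mem_filter.1 ha).2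
    rw [sum_congr rfl (g := fun _ => (q : ℤ) ^ (2 * d) - (-q) ^ d), sum_const, hone,
      nsmul_eq_mul]
    · push_cast
      ring
    · intro b hb
      replace hb := (mem_filter.1 hb).2
      rw [if_neg]
      · ring
      -- As N(a) = 1, the exceptional case would force b = σ(h(v, w)) a, hence N(h(v, w)) = N(b) =
      -- 1, which is excluded. So every pair (a, b) contributes the same amount, whatever h(v, w)
      -- is.
      · rw [ha, sub_self, zero_mul]
        intro h0
        have hb0 : b - σ (h v w) * a = 0 := by
          rcases mul_eq_zero.1 h0.symm with h1 | h1
          · exact h1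
          · exact (map_eq_zero σ).1 h1
        apply hne
        rw [sub_eq_zero.1 hb0, map_mul, H.frob.apply_apply] at hb
        linear_combination hb - h v w * σ (h v w) * ha

theorem IsUnitary.card_form_zero_of_ne (H : IsUnitary q h) {d : ℕ}
    (hn : Module.finrank F V = d + 2) {v w : V} (hv : h v v = 1) (hw : h w w = 1)
    (hne : h v w * σ (h v w) ≠ 1) :
    (q : ℤ) * #{z : V | h z z = 1 ∧ h v z = 0 ∧ h w z = 0} = q ^ (2 * d) - (-q) ^ d := by
  have := H.card_pair_of_ne hn hv hw hne 0 0 (map_one σ)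
  rw [if_neg (by simpa [sub_eq_zero] using Ne.symm hne)] at this
  have hset : (univ.filter fun z : V => h z z = 1 ∧ h v z = 0 ∧ h w z = 0)
      = univ.filter fun z : V => h v z = 0 ∧ h w z = 0 ∧ h z z = 1 := by
    ext z; simp only [mem_filter, mem_univ, true_and]; tauto
  rw [hset, this]
  ring

theorem IsUnitary.card_form_zero_of_tangent (H : IsUnitary q h) {d : ℕ}
    (hn : Module.finrank F V = d + 3) {v w : V} (hv : h v v = 1) (hw : h w w = 1)
    (hvw : h v w = 1) (hne : v ≠ w) :
    (q : ℤ) * #{z : V | h z z = 1 ∧ h v z = 0 ∧ h w z = 0}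
      = q ^ 2 * (q ^ (2 * d) - (-q) ^ d) := by
  have := H.card_pair_of_tangent hn hv hw hvw hne 0 0 (map_one σ)
  rw [if_pos rfl, if_neg (by simp)] at this
  have hset : (univ.filter fun z : V => h z z = 1 ∧ h v z = 0 ∧ h w z = 0)
      = univ.filter fun z : V => h v z = 0 ∧ h w z = 0 ∧ h z z = 1 := by
    ext z; simp only [mem_filter, mem_univ, true_and]; tauto
  rw [hset, this]
  ring

/-- Unit vectors having inner products of norm neither zero nor one with two orthogonal unit
vectors. -/
theorem IsUnitary.card_norm_ne_of_orthogonal (H : IsUnitary q h) {d : ℕ}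
    (hn : Module.finrank F V = d + 2) {v w : V} (hv : h v v = 1) (hw : h w w = 1)
    (hvw : h v w = 0) :
    (q : ℤ) * #{z : V | h z z = 1 ∧ (h v z * σ (h v z) ≠ 0 ∧ h v z * σ (h v z) ≠ 1) ∧
        (h w z * σ (h w z) ≠ 0 ∧ h w z * σ (h w z) ≠ 1)}
      = (q - 2) * (q + 1) * ((q - 2) * (q + 1) * q ^ (2 * d)
        + (-q) ^ d * (q * (q + 1) - (q - 2) * (q + 1))) := by
  rw [card_eq_sum_card_coords v w (fun a => a * σ a ≠ 0 ∧ a * σ a ≠ 1)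
    (fun b => b * σ b ≠ 0 ∧ b * σ b ≠ 1)]
  push_cast
  rw [mul_sum]
  have hne : h v w * σ (h v w) ≠ 1 := by rw [hvw, zero_mul]; exact zero_ne_one
  simp only [mul_sum, H.card_pair_of_ne hn hv hw hne _ _ (map_one σ)]
  have hcard : (#{a : F | a * σ a ≠ 0 ∧ a * σ a ≠ 1} : ℤ) = (q - 2) * (q + 1) := by
    rw [H.frob.card_norm_ne, Nat.cast_mul, Nat.cast_sub H.frob.one_lt]
    push_cast
    rfl
  rw [sum_congr rfl (g := fun _ => (q - 2 : ℤ) * (q + 1) * q ^ (2 * d)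
        + (-q) ^ d * (q * (q + 1) - (q - 2) * (q + 1))), sum_const, nsmul_eq_mul, hcard]
  intro a ha
  obtain ⟨ha0, ha1⟩ := (mem_filter.1 ha).2
  have hfix : σ (1 - a * σ a) = 1 - a * σ a := by
    rw [map_sub, map_one, H.frob.apply_mul_self]
  have hcount := H.frob.card_norm hfix
  rw [if_neg (sub_ne_zero.2 (Ne.symm ha1))] at hcount
  have hterm : ∀ b : F, (q : ℤ) ^ (2 * d) + (-q) ^ d *
      (if (1 - a * σ a) * (1 - h v w * σ (h v w))
          = (b - σ (h v w) * a) * σ (b - σ (h v w) * a) then (q : ℤ) - 1 else -1)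
      = (q ^ (2 * d) - (-q) ^ d) + (-q) ^ d * (if b * σ b = 1 - a * σ a then (q : ℤ) else 0) := by
    intro b
    simp only [hvw, map_zero, zero_mul, sub_zero, mul_one, eq_comm (a := 1 - a * σ a)]
    split_ifs <;> ring
  simp only [hterm]
  rw [sum_add_distrib, sum_const, nsmul_eq_mul, hcard, ← mul_sum, ← sum_filter, filter_filter]
  -- Since N(a) is neither 0 nor 1, the equation N(b) = 1 - N(a) already keeps N(b) away from 0 and
  -- 1.
  have hset : (univ.filter fun b : F => (b * σ b ≠ 0 ∧ b * σ b ≠ 1) ∧ b * σ b = 1 - a * σ a)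
      = univ.filter fun b : F => b * σ b = 1 - a * σ a := by
    ext b
    simp only [mem_filter, mem_univ, true_and, and_iff_right_iff_imp]
    intro hb
    rw [hb]
    refine ⟨sub_ne_zero.2 (Ne.symm ha1), fun h1 => ha0 ?_⟩
    linear_combination -h1
  rw [hset, sum_const, hcount, nsmul_eq_mul]
  push_cast
  ring

/-- Unit vectors having inner products of norm neither zero nor one with two unit vectors on a
tangent. -/
theorem IsUnitary.card_norm_ne_of_tangent (H : IsUnitary q h) {d : ℕ}
    (hn : Module.finrank F V = d + 3) {v w : V} (hv : h v v = 1) (hw : h w w = 1)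
    (hvw : h v w = 1) (hne : v ≠ w) :
    (q : ℤ) * #{z : V | h z z = 1 ∧ (h v z * σ (h v z) ≠ 0 ∧ h v z * σ (h v z) ≠ 1) ∧
        (h w z * σ (h w z) ≠ 0 ∧ h w z * σ (h w z) ≠ 1)}
      = (q - 2) * (q + 1) * ((q - 2) * (q + 1) * q ^ (2 * d + 2) - q ^ 2 * (-q) ^ d) := by
  rw [card_eq_sum_card_coords v w (fun a => a * σ a ≠ 0 ∧ a * σ a ≠ 1)
    (fun b => b * σ b ≠ 0 ∧ b * σ b ≠ 1)]
  push_cast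
  rw [mul_sum]
  simp only [mul_sum, H.card_pair_of_tangent hn hv hw hvw hne _ _ (map_one σ)]
  have hcard : (#{a : F | a * σ a ≠ 0 ∧ a * σ a ≠ 1} : ℤ) = (q - 2) * (q + 1) := by
    rw [H.frob.card_norm_ne, Nat.cast_mul, Nat.cast_sub H.frob.one_lt]
    push_cast
    rfl
  rw [sum_congr rfl (g := fun _ => (q - 2 : ℤ) * (q + 1) * q ^ (2 * d + 2) - q ^ 2 * (-q) ^ d),
    sum_const, nsmul_eq_mul, hcard]
  intro a ha
  -- N(a) ≠ 1 rules out the value `q - 1`, so only the diagonal term a = b deviates from `q ^ (2 * d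
  -- + 2)`.
  have hterm : ∀ b : F, (if a = b then
        (q : ℤ) ^ 2 * (q ^ (2 * d) + (-q) ^ d * (if 1 = a * σ a then (q : ℤ) - 1 else -1))
        else (q : ℤ) ^ (2 * d + 2))
      = (q : ℤ) ^ (2 * d + 2) + (if a = b then - ((q : ℤ) ^ 2 * (-q) ^ d) else 0) := by
    intro b
    rw [if_neg (Ne.symm (mem_filter.1 ha).2.2)]
    split_ifs <;> ring
  simp only [hterm]
  rw [sum_add_distrib, sum_const, nsmul_eq_mul, hcard, sum_ite_eq, if_pos ha]
  ring

end Sums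

/-! ### The invariant of a pair of points, tangents, and point counts -/

section Points

variable {F V : Type*} [Field F] [AddCommGroup V] [Module F V] {σ : F →+* F}
variable {h : V →ₛₗ[σ] V →ₗ[F] F} {q : ℕ}

/-- The invariant `N(h(v, w)) / (h(v, v) h(w, w))` of the pair of points `⟨v⟩`, `⟨w⟩`. -/
noncomputable def normInvariant (P Q : NonsingularPoint h) : F :=
  h P.2.choose Q.2.choose * σ (h P.2.choose Q.2.choose) /
    (h P.2.choose P.2.choose * h Q.2.choose Q.2.choose)

theorem span_unit_eq_iff {v w : V} (hv : h v v = 1) (hw : h w w = 1) :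
    F ∙ v = F ∙ w ↔ ∃ a : F, a * σ a = 1 ∧ v = a • w := by
  constructor
  · intro hvw
    obtain ⟨a, rfl⟩ := Submodule.mem_span_singleton.1 (hvw ▸ Submodule.mem_span_singleton_self v)
    refine ⟨a, ?_, rfl⟩
    rwa [form_smul_left, form_smul_right, hw, mul_one, mul_comm] at hv
  · rintro ⟨a, ha, rfl⟩
    exact Submodule.span_singleton_smul_eq
      (IsUnit.mk0 a (left_ne_zero_of_mul_eq_one ha)) w

theorem IsUnitary.form_norm_comm (H : IsUnitary q h) (v w : V) :
    h v w * σ (h v w) = h w v * σ (h w v) := by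
  rw [H.conj, H.conj, mul_comm]

/-- Nonsingular points as subspaces. -/
def NonsingularPoint.toSubmodule (h : V →ₛₗ[σ] V →ₗ[F] F) :
    NonsingularPoint h ↪ Submodule F V :=
  ⟨fun P => P.1, fun _ _ hPQ => Subtype.ext hPQ⟩

theorem smul_val (g : SU h) (P : NonsingularPoint h) :
    (g • P).1 = P.1.map g.1.toLinearMap := rfl

theorem smul_val_eq {g : SU h} {P : NonsingularPoint h} {v : V} (hP : P.1 = F ∙ v) :
    (g • P).1 = F ∙ (g.1 v) := by
  rw [smul_val, hP, Submodule.map_span, Set.image_singleton]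
  rfl

theorem smul_eq_of_apply_eq {g : SU h} {P Q : NonsingularPoint h} {v w : V} {a : F}
    (hP : P.1 = F ∙ v) (hQ : Q.1 = F ∙ w) (ha : a ≠ 0) (hg : g.1 v = a • w) : g • P = Q := by
  apply Subtype.ext
  rw [smul_val_eq hP, hg, hQ, Submodule.span_singleton_smul_eq (IsUnit.mk0 a ha)]

variable [Fintype F]

/-- The quotient is unchanged when either vector is rescaled, so the chosen spanning vectors may be
replaced by unit vectors. -/
theorem IsUnitary.normInvariant_eq (H : IsUnitary q h) {P Q : NonsingularPoint h} {v w : V}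
    (hv : h v v = 1) (hw : h w w = 1) (hP : P.1 = F ∙ v) (hQ : Q.1 = F ∙ w) :
    normInvariant P Q = h v w * σ (h v w) := by
  have hP' := P.2.choose_spec
  have hQ' := Q.2.choose_spec
  unfold normInvariant
  set v' := P.2.choose
  set w' := Q.2.choose
  obtain ⟨a, ha⟩ := Submodule.mem_span_singleton.1
    ((hP'.2.symm.trans hP) ▸ Submodule.mem_span_singleton_self v' : v' ∈ F ∙ v)
  obtain ⟨b, hb⟩ := Submodule.mem_span_singleton.1
    ((hQ'.2.symm.trans hQ) ▸ Submodule.mem_span_singleton_self w' : w' ∈ F ∙ w)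
  have ha0 : a ≠ 0 := by
    rintro rfl
    rw [← ha] at hP'
    simp at hP'
  have hb0 : b ≠ 0 := by
    rintro rfl
    rw [← hb] at hQ'
    simp at hQ'
  have hσa : σ a ≠ 0 := (map_ne_zero σ).2 ha0
  have hσb : σ b ≠ 0 := (map_ne_zero σ).2 hb0
  rw [← ha, ← hb]
  simp only [form_smul_left, form_smul_right, hv, hw, map_mul, H.frob.apply_apply]
  field_simp

theorem IsUnitary.exists_unit (H : IsUnitary q h) (P : NonsingularPoint h) :
    ∃ v, h v v = 1 ∧ P.1 = F ∙ v := by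
  obtain ⟨v, hv, hP⟩ := P.2
  obtain ⟨a, ha, hav⟩ := H.exists_smul_norm_one hv
  exact ⟨a • v, hav, by rw [hP, Submodule.span_singleton_smul_eq (IsUnit.mk0 a ha)]⟩

theorem IsUnitary.normInvariant_comm (H : IsUnitary q h) (P Q : NonsingularPoint h) :
    normInvariant P Q = normInvariant Q P := by
  obtain ⟨v, hv, hP⟩ := H.exists_unit P
  obtain ⟨w, hw, hQ⟩ := H.exists_unit Q
  rw [H.normInvariant_eq hv hw hP hQ, H.normInvariant_eq hw hv hQ hP, H.form_norm_comm]

theorem IsUnitary.normInvariant_self (H : IsUnitary q h) (P : NonsingularPoint h) :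
    normInvariant P P = 1 := by
  obtain ⟨v, hv, hP⟩ := H.exists_unit P
  rw [H.normInvariant_eq hv hv hP hP, hv, map_one, one_mul]

theorem IsUnitary.map_normInvariant (H : IsUnitary q h) (P Q : NonsingularPoint h) :
    σ (normInvariant P Q) = normInvariant P Q := by
  obtain ⟨v, hv, hP⟩ := H.exists_unit P
  obtain ⟨w, hw, hQ⟩ := H.exists_unit Q
  rw [H.normInvariant_eq hv hw hP hQ, H.frob.apply_mul_self]

theorem IsUnitary.normInvariant_smul (H : IsUnitary q h) (g : SU h) (P Q : NonsingularPoint h) :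
    normInvariant (g • P) (g • Q) = normInvariant P Q := by
  obtain ⟨v, hv, hP⟩ := H.exists_unit P
  obtain ⟨w, hw, hQ⟩ := H.exists_unit Q
  rw [H.normInvariant_eq hv hw hP hQ, H.normInvariant_eq (by rw [g.2.1, hv]) (by rw [g.2.1, hw])
    (smul_val_eq hP) (smul_val_eq hQ), g.2.1]

/-- `SU` is transitive on nonsingular points. -/
theorem IsUnitary.exists_smul_eq [FiniteDimensional F V] (H : IsUnitary q h)
    (hq : q = 3 ∨ q = 4) (hn : 3 ≤ Module.finrank F V) (P Q : NonsingularPoint h) :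
    ∃ g : SU h, g • P = Q := by
  obtain ⟨v, hv, hP⟩ := H.exists_unit P
  obtain ⟨w, hw, hQ⟩ := H.exists_unit Q
  obtain ⟨g, hg, a, ha, hga⟩ := H.exists_SU_vector hq hn hv hw
  exact ⟨⟨g, hg⟩, smul_eq_of_apply_eq hP hQ ha hga⟩

/-- Unit vectors spanning `P` and `Q` whose inner product is a prescribed element. -/
theorem IsUnitary.exists_unit_pair (H : IsUnitary q h) (P Q : NonsingularPoint h) {x : F}
    (hx : x * σ x = normInvariant P Q) :
    ∃ v w, h v v = 1 ∧ h w w = 1 ∧ P.1 = F ∙ v ∧ Q.1 = F ∙ w ∧ h v w = x := by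
  obtain ⟨v, hv, hP⟩ := H.exists_unit P
  obtain ⟨w, hw, hQ⟩ := H.exists_unit Q
  rw [H.normInvariant_eq hv hw hP hQ] at hx
  by_cases hx0 : x = 0
  · subst hx0
    exact ⟨v, w, hv, hw, hP, hQ, by simpa using hx.symm⟩
  · have hy0 : h v w ≠ 0 := by
      intro h0
      rw [h0, zero_mul] at hx
      exact hx0 (by simpa using hx)
    have ha : (x / h v w) ≠ 0 := div_ne_zero hx0 hy0
    refine ⟨v, (x / h v w) • w, hv, ?_, hP, ?_, ?_⟩
    · have hσ : σ (h v w) ≠ 0 := (map_ne_zero σ).2 hy0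
      rw [form_smul_left, form_smul_right, hw, map_div₀, mul_one, div_mul_div_comm,
        div_eq_one_iff_eq (mul_ne_zero hσ hy0)]
      linear_combination hx
    · rw [hQ, Submodule.span_singleton_smul_eq (IsUnit.mk0 _ ha)]
    · rw [form_smul_right, div_mul_cancel₀ _ hy0]

/-- Fixes a common target for the inner product of unit representatives; the target must be exactly
1 for tangents, as their normal form requires. -/
theorem IsUnitary.exists_norm_eq_normInvariant (H : IsUnitary q h) (P Q : NonsingularPoint h) :
    ∃ x : F, x * σ x = normInvariant P Q ∧ (normInvariant P Q = 1 → x = 1) := by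
  by_cases h1 : normInvariant P Q = 1
  · exact ⟨1, by rw [h1, map_one, one_mul], fun _ => rfl⟩
  · obtain ⟨x, hx⟩ := H.frob.exists_norm_eq (H.map_normInvariant P Q)
    exact ⟨x, hx, fun h => absurd h h1⟩

/-- Pairs of distinct points with the same invariant form one orbit of `SU`. -/
theorem IsUnitary.exists_smul_pair_eq [FiniteDimensional F V] (H : IsUnitary q h)
    (hq : q = 3 ∨ q = 4) (hn : 3 ≤ Module.finrank F V) {P Q P' Q' : NonsingularPoint h}
    (hPQ : P ≠ Q) (hPQ' : P' ≠ Q') (heq : normInvariant P Q = normInvariant P' Q') :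
    ∃ g : SU h, g • P = P' ∧ g • Q = Q' := by
  obtain ⟨x, hx, hx1⟩ := H.exists_norm_eq_normInvariant P Q
  obtain ⟨v, w, hv, hw, hP, hQ, hvw⟩ := H.exists_unit_pair P Q hx
  obtain ⟨v', w', hv', hw', hP', hQ', hvw'⟩ := H.exists_unit_pair P' Q' (hx.trans heq)
  obtain ⟨g, hg, a, ha, hgv, hgw⟩ := H.exists_SU_pair hq hn hv hw hv' hw' (by rw [hvw, hvw']) (by
    intro h1
    refine ⟨hvw.trans (hx1 (by rw [← hx, ← hvw, h1])), ?_, ?_⟩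
    · rintro rfl
      exact hPQ (Subtype.ext (hP.trans hQ.symm))
    · rintro rfl
      exact hPQ' (Subtype.ext (hP'.trans hQ'.symm)))
  exact ⟨⟨g, hg⟩, smul_eq_of_apply_eq hP hP' ha hgv, smul_eq_of_apply_eq hQ hQ' ha hgw⟩

/-- The line through two distinct points is a tangent iff the invariant is one. -/
theorem IsUnitary.NU_adj_iff (H : IsUnitary q h) {P Q : NonsingularPoint h} :
    (NU h).Adj P Q ↔ P ≠ Q ∧ normInvariant P Q = 1 := by
  change (P ≠ Q ∧ _) ↔ _
  refine and_congr_right fun hPQ => ?_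
  obtain ⟨x, hx, hx1⟩ := H.exists_norm_eq_normInvariant P Q
  obtain ⟨v, w, hv, hw, hP, hQ, hvw⟩ := H.exists_unit_pair P Q hx
  have hsup : P.1 ⊔ Q.1 = Submodule.span F {v, w} := by
    rw [hP, hQ, ← Submodule.span_union, Set.singleton_union]
  have hne : v ≠ w := by
    rintro rfl
    exact hPQ (Subtype.ext (hP.trans hQ.symm))
  constructor
  · rintro ⟨R, -, hR⟩
    by_contra hc
    obtain ⟨c, hcN⟩ := H.frob.exists_norm_eq (t := 1 - h v w * σ (h v w))
      (by rw [map_sub, map_one, H.frob.apply_mul_self])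
    have hc0 : c ≠ 0 := by
      rintro rfl
      rw [zero_mul, hvw, hx] at hcN
      exact hc (sub_eq_zero.1 hcN.symm).symm
    obtain ⟨e, hf, hwe⟩ := H.exists_orthonormal_of_ne hv hw hc0 hcN
    have hee : h e e = 1 := by simpa using hf 0 0
    have hve : h v e = 0 := by simpa using hf 1 0
    have hmem_e : e ∈ Submodule.span F {v, w} := by
      have h1 : c • e = w - h v w • v := eq_sub_iff_add_eq'.2 hwe.symm
      rw [← inv_smul_smul₀ hc0 e, h1]
      exact Submodule.smul_mem _ _ (sub_mem (Submodule.subset_span (by simp))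
        (Submodule.smul_mem _ _ (Submodule.subset_span (by simp))))
    -- In a nondegenerate plane with orthonormal basis v, e, the q + 1 elements ζ of norm -1 give
    -- distinct singular points ⟨v + ζ e⟩, contradicting uniqueness.
    have key : ∀ ζ : F, ζ * σ ζ = -1 → F ∙ (v + ζ • e) = R := by
      intro ζ hζ
      refine hR _ ⟨⟨v + ζ • e, ?_, ?_, rfl⟩, ?_⟩
      · intro h0
        have := congrArg (h v) h0
        rw [map_add, form_smul_right, hv, hve, map_zero, mul_zero, add_zero] at this
        exact one_ne_zero this
      · rw [H.form_add_smul, hv, hve, hee, hζ]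
        simp
      · rw [hsup, Submodule.span_singleton_le_iff_mem]
        exact add_mem (Submodule.subset_span (by simp)) (Submodule.smul_mem _ _ hmem_e)
    have hcard := H.frob.card_norm_fiber (t := -1) (by rw [map_neg, map_one])
      (neg_ne_zero.2 one_ne_zero)
    obtain ⟨ζ, hζ, ζ', hζ', hζζ⟩ := one_lt_card.1
      (by rw [hcard]; have := H.frob.one_lt; omega : 1 < #{a : F | a * σ a = -1})
    replace hζ := (mem_filter.1 hζ).2
    replace hζ' := (mem_filter.1 hζ').2
    obtain ⟨a, ha⟩ := Submodule.mem_span_singleton.1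
      (((key ζ hζ).trans (key ζ' hζ').symm) ▸ Submodule.mem_span_singleton_self (v + ζ • e) :
        v + ζ • e ∈ F ∙ (v + ζ' • e))
    have h1 := congrArg (h v) ha
    simp only [form_smul_right, map_add, hv, hve, mul_zero, add_zero, mul_one] at h1
    have hev : h e v = 0 := by rw [← H.conj, hve, map_zero]
    have h2 := congrArg (h e) ha
    simp only [form_smul_right, map_add, hev, hee, mul_one, zero_add, h1, one_mul] at h2
    exact hζζ h2.symm
  · intro h1
    have hx1' := hx1 h1
    rw [hx1'] at hvw
    have hwv : h w v = 1 := by rw [← H.conj, hvw, map_one]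
    refine ⟨F ∙ (w - v), ⟨⟨w - v, sub_ne_zero.2 hne.symm, ?_, rfl⟩, ?_⟩, ?_⟩
    · simp [map_sub, LinearMap.sub_apply, hv, hw, hvw, hwv]
    · rw [hsup, Submodule.span_singleton_le_iff_mem]
      exact sub_mem (Submodule.subset_span (by simp)) (Submodule.subset_span (by simp))
    · rintro R ⟨⟨r, hr0, hrr, rfl⟩, hR⟩
      rw [hsup, Submodule.span_singleton_le_iff_mem, Submodule.mem_span_pair] at hR
      obtain ⟨a, b, rfl⟩ := hR
      -- When h(v, w) = 1 the norm of a v + b w is N(a + b), so ⟨w - v⟩ is the only singular point.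
      have hab : (a + b) * σ (a + b) = 0 := by
        rw [← hrr]
        simp only [map_add, LinearMap.add_apply, form_smul_left, form_smul_right, hv, hw, hvw,
          hwv]
        ring
      have hab' : a = -b := by
        rcases mul_eq_zero.1 hab with h2 | h2
        · exact eq_neg_of_add_eq_zero_left h2
        · exact eq_neg_of_add_eq_zero_left ((map_eq_zero σ).1 h2)
      subst hab'
      have hb : b ≠ 0 := by
        rintro rfl
        simp at hr0
      have : -b • v + b • w = b • (w - v) := by
        rw [smul_sub, neg_smul]
        abel
      rw [this, Submodule.span_singleton_smul_eq (IsUnit.mk0 b hb)]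

/-! ### Counting points -/

variable [Fintype V] [Fintype (NonsingularPoint h)]

/-- Each nonsingular point contains exactly q + 1 unit vectors, the multiples of one of them by the
scalars of norm one. -/
theorem IsUnitary.card_points (H : IsUnitary q h) (p : NonsingularPoint h → Prop) (p' : V → Prop)
    [DecidablePred p] [DecidablePred p']
    (hp : ∀ Z z, h z z = 1 → Z.1 = F ∙ z → (p Z ↔ p' z)) :
    (q + 1) * #{Z | p Z} = #{z : V | h z z = 1 ∧ p' z} := by
  rw [card_eq_sum_card_fiberwise (f := fun z => F ∙ z)
    (t := (univ.filter p).map (NonsingularPoint.toSubmodule h)), sum_map]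
  · rw [sum_congr rfl (g := fun _ => q + 1), sum_const, smul_eq_mul, mul_comm]
    intro Z hZ
    obtain ⟨v, hv, hZv⟩ := H.exists_unit Z
    have hone := H.frob.card_norm_fiber (map_one σ) one_ne_zero
    rw [← hone, filter_filter]
    symm
    refine card_bij (fun a _ => a • v) ?_ ?_ ?_
    · intro a ha
      replace ha := (mem_filter.1 ha).2
      have h1 : h (a • v) (a • v) = 1 := by
        rw [form_smul_left, form_smul_right, hv, mul_one, mul_comm, ha]
      have h2 : F ∙ (a • v) = Z.1 := by
        rw [hZv, (span_unit_eq_iff h1 hv)]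
        exact ⟨a, ha, rfl⟩
      simp only [mem_filter, mem_univ, true_and]
      exact ⟨⟨h1, (hp Z _ h1 h2.symm).1 (mem_filter.1 hZ).2⟩, h2⟩
    · intro a _ b _ hab
      have := congrArg (h v) hab
      rwa [form_smul_right, form_smul_right, hv, mul_one, mul_one] at this
    · intro z hz
      simp only [mem_filter, mem_univ, true_and] at hz
      obtain ⟨a, ha, rfl⟩ := (span_unit_eq_iff hz.1.1 hv).1 (hz.2.trans hZv)
      exact ⟨a, by simpa using ha, rfl⟩
  · intro z hz
    have hz' := (mem_filter.1 hz).2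
    rw [mem_coe, mem_map]
    refine ⟨⟨F ∙ z, z, by rw [hz'.1]; exact one_ne_zero, rfl⟩,
      mem_filter.2 ⟨mem_univ _, (hp _ z hz'.1 rfl).2 hz'.2⟩, rfl⟩

variable [FiniteDimensional F V]

theorem IsUnitary.card_normInvariant_eq (H : IsUnitary q h) {d : ℕ}
    (hn : Module.finrank F V = d + 1) (P : NonsingularPoint h) {c : F} (hc : σ c = c) :
    (q : ℤ) * ((q + 1) * #{Z | normInvariant P Z = c})
      = (if c = 0 then 1 else (q : ℤ) + 1) *
        (q ^ (2 * d) + (-q) ^ d * (if c = 1 then (q : ℤ) - 1 else -1)) := by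
  obtain ⟨v, hv, hP⟩ := H.exists_unit P
  rw [← H.card_norm_form_eq hn hv hc, ← H.card_points (fun Z => normInvariant P Z = c)
    (fun z => h v z * σ (h v z) = c)]
  · push_cast
    rfl
  · intro Z z hz hZ
    rw [H.normInvariant_eq hv hz hP hZ]

theorem IsUnitary.card_common_one (H : IsUnitary q h) {d : ℕ}
    (hn : Module.finrank F V = d + 2) {P Q : NonsingularPoint h} (hPQ : normInvariant P Q ≠ 1) :
    (q : ℤ) * ((q + 1) * #{Z | normInvariant P Z = 1 ∧ normInvariant Q Z = 1})
      = ((q : ℤ) + 1) ^ 2 * (q ^ (2 * d) - (-q) ^ d) := by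
  obtain ⟨v, hv, hP⟩ := H.exists_unit P
  obtain ⟨w, hw, hQ⟩ := H.exists_unit Q
  rw [H.normInvariant_eq hv hw hP hQ] at hPQ
  rw [← H.card_norm_one_of_ne hn hv hw hPQ, ← H.card_points
    (fun Z => normInvariant P Z = 1 ∧ normInvariant Q Z = 1)
    (fun z => h v z * σ (h v z) = 1 ∧ h w z * σ (h w z) = 1)]
  · push_cast
    rfl
  · intro Z z hz hZ
    rw [H.normInvariant_eq hv hz hP hZ, H.normInvariant_eq hw hz hQ hZ]

theorem IsUnitary.card_common_zero_of_ne (H : IsUnitary q h) {d : ℕ}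
    (hn : Module.finrank F V = d + 2) {P Q : NonsingularPoint h} (hPQ : normInvariant P Q ≠ 1) :
    (q : ℤ) * ((q + 1) * #{Z | normInvariant P Z = 0 ∧ normInvariant Q Z = 0})
      = q ^ (2 * d) - (-q) ^ d := by
  obtain ⟨v, hv, hP⟩ := H.exists_unit P
  obtain ⟨w, hw, hQ⟩ := H.exists_unit Q
  rw [H.normInvariant_eq hv hw hP hQ] at hPQ
  rw [← H.card_form_zero_of_ne hn hv hw hPQ, ← H.card_points
    (fun Z => normInvariant P Z = 0 ∧ normInvariant Q Z = 0)
    (fun z => h v z = 0 ∧ h w z = 0)]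
  · push_cast
    rfl
  · intro Z z hz hZ
    rw [H.normInvariant_eq hv hz hP hZ, H.normInvariant_eq hw hz hQ hZ]
    simp

theorem IsUnitary.card_common_zero_of_tangent (H : IsUnitary q h) {d : ℕ}
    (hn : Module.finrank F V = d + 3) {P Q : NonsingularPoint h} (hPQ : normInvariant P Q = 1)
    (hne : P ≠ Q) :
    (q : ℤ) * ((q + 1) * #{Z | normInvariant P Z = 0 ∧ normInvariant Q Z = 0})
      = q ^ 2 * (q ^ (2 * d) - (-q) ^ d) := by
  obtain ⟨v, w, hv, hw, hP, hQ, hvw⟩ := H.exists_unit_pair P Q (x := 1)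
    (by rw [hPQ, map_one, one_mul])
  have hvw' : v ≠ w := by
    rintro rfl
    exact hne (Subtype.ext (hP.trans hQ.symm))
  rw [← H.card_form_zero_of_tangent hn hv hw hvw hvw', ← H.card_points
    (fun Z => normInvariant P Z = 0 ∧ normInvariant Q Z = 0)
    (fun z => h v z = 0 ∧ h w z = 0)]
  · push_cast
    rfl
  · intro Z z hz hZ
    rw [H.normInvariant_eq hv hz hP hZ, H.normInvariant_eq hw hz hQ hZ]
    simp

theorem IsUnitary.card_common_other_of_zero (H : IsUnitary q h) {d : ℕ}
    (hn : Module.finrank F V = d + 2) {P Q : NonsingularPoint h} (hPQ : normInvariant P Q = 0) :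
    (q : ℤ) * ((q + 1) * #{Z | (normInvariant P Z ≠ 0 ∧ normInvariant P Z ≠ 1) ∧
        (normInvariant Q Z ≠ 0 ∧ normInvariant Q Z ≠ 1)})
      = (q - 2) * (q + 1) * ((q - 2) * (q + 1) * q ^ (2 * d)
        + (-q) ^ d * (q * (q + 1) - (q - 2) * (q + 1))) := by
  obtain ⟨v, w, hv, hw, hP, hQ, hvw⟩ := H.exists_unit_pair P Q (x := 0)
    (by rw [hPQ, zero_mul])
  rw [← H.card_norm_ne_of_orthogonal hn hv hw hvw, ← H.card_points
    (fun Z => (normInvariant P Z ≠ 0 ∧ normInvariant P Z ≠ 1) ∧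
        (normInvariant Q Z ≠ 0 ∧ normInvariant Q Z ≠ 1))
    (fun z => (h v z * σ (h v z) ≠ 0 ∧ h v z * σ (h v z) ≠ 1) ∧
        (h w z * σ (h w z) ≠ 0 ∧ h w z * σ (h w z) ≠ 1))]
  · push_cast
    rfl
  · intro Z z hz hZ
    rw [H.normInvariant_eq hv hz hP hZ, H.normInvariant_eq hw hz hQ hZ]

theorem IsUnitary.card_common_other_of_tangent (H : IsUnitary q h) {d : ℕ}
    (hn : Module.finrank F V = d + 3) {P Q : NonsingularPoint h} (hPQ : normInvariant P Q = 1)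
    (hne : P ≠ Q) :
    (q : ℤ) * ((q + 1) * #{Z | (normInvariant P Z ≠ 0 ∧ normInvariant P Z ≠ 1) ∧
        (normInvariant Q Z ≠ 0 ∧ normInvariant Q Z ≠ 1)})
      = (q - 2) * (q + 1) * ((q - 2) * (q + 1) * q ^ (2 * d + 2) - q ^ 2 * (-q) ^ d) := by
  obtain ⟨v, w, hv, hw, hP, hQ, hvw⟩ := H.exists_unit_pair P Q (x := 1)
    (by rw [hPQ, map_one, one_mul])
  have hvw' : v ≠ w := by
    rintro rfl
    exact hne (Subtype.ext (hP.trans hQ.symm))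
  rw [← H.card_norm_ne_of_tangent hn hv hw hvw hvw', ← H.card_points
    (fun Z => (normInvariant P Z ≠ 0 ∧ normInvariant P Z ≠ 1) ∧
        (normInvariant Q Z ≠ 0 ∧ normInvariant Q Z ≠ 1))
    (fun z => (h v z * σ (h v z) ≠ 0 ∧ h v z * σ (h v z) ≠ 1) ∧
        (h w z * σ (h w z) ≠ 0 ∧ h w z * σ (h w z) ≠ 1))]
  · push_cast
    rfl
  · intro Z z hz hZ
    rw [H.normInvariant_eq hv hz hP hZ, H.normInvariant_eq hw hz hQ hZ]

end Points

/-! ### Types of pairs, valencies and common neighbours -/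

section Types

theorem pow_ne_neg_pow {q j k : ℕ} (hq : 1 < q) (hjk : j ≠ k) : (q : ℤ) ^ k ≠ (-q) ^ j := by
  intro h0
  have := congrArg Int.natAbs h0
  rw [Int.natAbs_pow, Int.natAbs_pow, Int.natAbs_neg, Int.natAbs_natCast] at this
  exact hjk (Nat.pow_right_injective hq this).symm

theorem card_eq_card_of_mul {q : ℕ} {x y : ℕ} {s : ℤ} (hq : 0 < q)
    (hx : (q : ℤ) * ((q + 1) * x) = s) (hy : (q : ℤ) * ((q + 1) * y) = s) : x = y := by
  have hq0 : (q : ℤ) ≠ 0 := by positivity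
  have hq2 : (q : ℤ) + 1 ≠ 0 := by positivity
  exact_mod_cast mul_left_cancel₀ hq2 (mul_left_cancel₀ hq0 (hx.trans hy.symm))

variable {F V : Type*} [Field F] [AddCommGroup V] [Module F V] {σ : F →+* F}
variable {h : V →ₛₗ[σ] V →ₗ[F] F} {q : ℕ}

/-- The four kinds of pairs of nonsingular points: equal (`0`), on a tangent (`1`),
orthogonal (`2`), and all others (`3`). -/
noncomputable def pairType (P Q : NonsingularPoint h) : Fin 4 :=
  if P = Q then 0 else if normInvariant P Q = 1 then 1 else if normInvariant P Q = 0 then 2 else 3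

theorem pairType_eq_zero {P Q : NonsingularPoint h} : pairType P Q = 0 ↔ P = Q := by
  unfold pairType
  split_ifs <;> simp_all

theorem pairType_eq_one {P Q : NonsingularPoint h} :
    pairType P Q = 1 ↔ P ≠ Q ∧ normInvariant P Q = 1 := by
  unfold pairType
  split_ifs <;> simp_all

variable [Fintype F]

theorem IsUnitary.pairType_eq_two (H : IsUnitary q h) {P Q : NonsingularPoint h} :
    pairType P Q = 2 ↔ normInvariant P Q = 0 := by
  unfold pairType
  split_ifs with h1 h2 h3
  · subst h1
    simp [H.normInvariant_self]
  · simp [h2]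
  · simp [h3]
  · simp [h3]

theorem IsUnitary.pairType_eq_three (H : IsUnitary q h) {P Q : NonsingularPoint h} :
    pairType P Q = 3 ↔ normInvariant P Q ≠ 0 ∧ normInvariant P Q ≠ 1 := by
  unfold pairType
  split_ifs with h1 h2 h3
  · subst h1
    simp [H.normInvariant_self]
  · simp [h2]
  · simp [h3]
  · simp [h3, h2]

theorem IsUnitary.pairType_comm (H : IsUnitary q h) (P Q : NonsingularPoint h) :
    pairType P Q = pairType Q P := by
  unfold pairType
  rw [H.normInvariant_comm P Q]
  simp only [eq_comm]

theorem IsUnitary.pairType_smul (H : IsUnitary q h) (g : SU h) (P Q : NonsingularPoint h) :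
    pairType (g • P) (g • Q) = pairType P Q := by
  unfold pairType
  rw [H.normInvariant_smul]
  simp only [smul_left_cancel_iff]

/-- Turns the suborbits of SU into level sets of the invariant, so that their sizes become point
counts. -/
theorem IsUnitary.exists_smul_iff [FiniteDimensional F V] (H : IsUnitary q h)
    (hq : q = 3 ∨ q = 4) (hn : 3 ≤ Module.finrank F V) {P Q Z : NonsingularPoint h}
    (hPQ : P ≠ Q) : (∃ g : SU h, g • P = P ∧ g • Q = Z) ↔
      normInvariant P Z = normInvariant P Q ∧ P ≠ Z := by
  constructor
  · rintro ⟨g, h1, rfl⟩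
    refine ⟨?_, fun h2 => hPQ ?_⟩
    · conv_lhs => rw [← h1]
      rw [H.normInvariant_smul]
    · rw [← h1] at h2
      exact smul_left_cancel g h2
  · rintro ⟨h1, h2⟩
    exact H.exists_smul_pair_eq hq hn hPQ h2 h1.symm

variable [Fintype (NonsingularPoint h)]

theorem IsUnitary.card_suborbit_of_ne_one (H : IsUnitary q h) (P : NonsingularPoint h) {c : F}
    (hc : c ≠ 1) : #{Z | normInvariant P Z = c ∧ P ≠ Z} = #{Z | normInvariant P Z = c} := by
  congr 1
  ext Z
  simp only [mem_filter, mem_univ, true_and, and_iff_left_iff_imp]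
  rintro h1 rfl
  exact hc (h1.symm.trans (H.normInvariant_self P))

theorem IsUnitary.card_suborbit_one (H : IsUnitary q h) (P : NonsingularPoint h) :
    #{Z | normInvariant P Z = 1 ∧ P ≠ Z} + 1 = #{Z | normInvariant P Z = 1} := by
  have hP : P ∈ univ.filter fun Z => normInvariant P Z = 1 := by
    simpa using H.normInvariant_self P
  rw [← card_erase_add_one hP]
  congr 2
  ext Z
  simp only [mem_filter, mem_univ, true_and, mem_erase]
  tauto

variable [Fintype V] [FiniteDimensional F V]

/-- The numbers of points with given invariant, up to multiples of `q`. -/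
theorem IsUnitary.exists_valencies (H : IsUnitary q h) (hn : 3 ≤ Module.finrank F V) :
    ∃ a b : ℤ, a ≠ 0 ∧ ∀ P : NonsingularPoint h,
      ((q : ℤ) + 1) * #{Z | normInvariant P Z = 0} = q * a ∧
      (#{Z | normInvariant P Z = 1} : ℤ) = q * b ∧
      ∀ c, σ c = c → c ≠ 0 → c ≠ 1 → (#{Z | normInvariant P Z = c} : ℤ) = q * a := by
  have hq1 := H.frob.one_lt
  obtain ⟨j, hj⟩ : ∃ j, Module.finrank F V = (j + 2) + 1 :=
    ⟨Module.finrank F V - 3, by omega⟩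
  have hq0 : (q : ℤ) ≠ 0 := by positivity
  have hq2 : (q : ℤ) + 1 ≠ 0 := by positivity
  -- The second factors on the right of `IsUnitary.card_normInvariant_eq`, in dimension j + 3,
  -- divided by q². The first is nonzero because 2j + 2 ≠ j.
  refine ⟨q ^ (2 * j + 2) - (-q) ^ j, q ^ (2 * j + 2) + (-q) ^ j * (q - 1),
    sub_ne_zero.2 (pow_ne_neg_pow hq1 (by omega)), fun P => ⟨?_, ?_, fun c hc h0 h1 => ?_⟩⟩
  · have := H.card_normInvariant_eq hj P (map_zero σ)
    rw [if_pos rfl, if_neg zero_ne_one] at this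
    apply mul_left_cancel₀ hq0
    rw [this]
    ring
  · have := H.card_normInvariant_eq hj P (map_one σ)
    rw [if_neg one_ne_zero, if_pos rfl] at this
    apply mul_left_cancel₀ hq2
    apply mul_left_cancel₀ hq0
    rw [this]
    ring
  · have := H.card_normInvariant_eq hj P hc
    rw [if_neg h0, if_neg h1] at this
    apply mul_left_cancel₀ hq2
    apply mul_left_cancel₀ hq0
    rw [this]
    ring

/-- The sizes of the suborbits determine the types of pairs. -/
theorem IsUnitary.pairType_eq_of_card_eq (H : IsUnitary q h) (hn : 3 ≤ Module.finrank F V)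
    {P Q P' Q' : NonsingularPoint h} (hPQ : P ≠ Q) (hPQ' : P' ≠ Q')
    (hcard : #{Z | normInvariant P Z = normInvariant P Q ∧ P ≠ Z}
      = #{Z | normInvariant P' Z = normInvariant P' Q' ∧ P' ≠ Z}) :
    pairType P Q = pairType P' Q' := by
  obtain ⟨a, b, ha, hab⟩ := H.exists_valencies hn
  have hq1 := H.frob.one_lt
  have hq0 : (q : ℤ) ≠ 0 := by positivity
  have hdvd : ¬ (q : ℤ) ∣ 1 := by
    intro h1
    have := Int.le_of_dvd one_pos h1
    omega
  set κ : NonsingularPoint h → NonsingularPoint h → ℤ := fun P Q =>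
    #{Z | normInvariant P Z = normInvariant P Q ∧ P ≠ Z} with hκ
  have k1 : ∀ {P Q : NonsingularPoint h}, pairType P Q = 1 → κ P Q + 1 = q * b := by
    intro P Q h1
    rw [← (hab P).2.1, ← H.card_suborbit_one P, hκ]
    simp only [(pairType_eq_one.1 h1).2]
    push_cast
    rfl
  have k2 : ∀ {P Q : NonsingularPoint h}, pairType P Q = 2 → (q + 1) * κ P Q = q * a := by
    intro P Q h1
    rw [← (hab P).1, hκ]
    simp only [H.pairType_eq_two.1 h1]
    rw [H.card_suborbit_of_ne_one P zero_ne_one]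
  have k3 : ∀ {P Q : NonsingularPoint h}, pairType P Q = 3 → κ P Q = q * a := by
    intro P Q h1
    have h2 := H.pairType_eq_three.1 h1
    rw [← (hab P).2.2 _ (H.map_normInvariant P Q) h2.1 h2.2, hκ]
    simp only
    rw [H.card_suborbit_of_ne_one P h2.2]
  -- A tangent suborbit has size -1 modulo q, while the other sizes are divisible by q. Types 2 and
  -- 3 differ by the factor q + 1, and a ≠ 0 separates them.
  have no12 : ∀ x : ℤ, x + 1 = q * b → (q + 1) * x = q * a → False := by
    intro x e1 e2
    exact hdvd ⟨(q + 1) * b - a - 1, by linear_combination -e2 + (q + 1) * e1⟩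
  have no13 : ∀ x : ℤ, x + 1 = q * b → x = q * a → False := by
    intro x e1 e2
    exact hdvd ⟨b - a, by linear_combination e1 - e2⟩
  have no23 : ∀ x : ℤ, (q + 1) * x = q * a → x = q * a → False := by
    intro x e1 e2
    have : (q : ℤ) * (q * a) = 0 := by linear_combination e1 - (q + 1) * e2
    exact mul_ne_zero hq0 (mul_ne_zero hq0 ha) this
  have hκ' : κ P Q = κ P' Q' := by
    simp only [hκ]
    exact_mod_cast hcard
  have cases : ∀ {P Q : NonsingularPoint h}, P ≠ Q →
      pairType P Q = 1 ∨ pairType P Q = 2 ∨ pairType P Q = 3 := by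
    intro P Q hne
    unfold pairType
    rw [if_neg hne]
    split_ifs <;> simp
  rcases cases hPQ with h1 | h1 | h1 <;> rcases cases hPQ' with h2 | h2 | h2 <;>
    rw [h1, h2] <;> exfalso
  · exact no12 _ (k1 h1) (hκ' ▸ k2 h2)
  · exact no13 _ (k1 h1) (hκ' ▸ k3 h2)
  · exact no12 _ (k1 h2) (hκ' ▸ k2 h1)
  · exact no23 _ (k2 h1) (hκ' ▸ k3 h2)
  · exact no13 _ (k1 h2) (hκ' ▸ k3 h1)
  · exact no23 _ (k2 h2) (hκ' ▸ k3 h1)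

/-- None of the valencies vanishes. Type 3 needs a norm other than 0 and 1, hence q ≥ 3. -/
theorem IsUnitary.exists_pairType_eq (H : IsUnitary q h) (hn : 3 ≤ Module.finrank F V)
    (hq : 3 ≤ q) (P : NonsingularPoint h) (i : Fin 4) : ∃ Q, pairType P Q = i := by
  obtain ⟨a, b, ha, hab⟩ := H.exists_valencies hn
  have hq0 : (q : ℤ) ≠ 0 := by positivity
  have exists_of_ne : ∀ (p : NonsingularPoint h → Prop) [DecidablePred p],
      (#{Z | p Z} : ℤ) ≠ 0 → ∃ Z, p Z := by
    intro p _ hp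
    obtain ⟨Z, hZ⟩ := card_ne_zero.1 (by exact_mod_cast hp : #{Z | p Z} ≠ 0)
    exact ⟨Z, (mem_filter.1 hZ).2⟩
  fin_cases i
  · exact ⟨P, pairType_eq_zero.2 rfl⟩
  · obtain ⟨Q, hQ⟩ := exists_of_ne (fun Z => normInvariant P Z = 1 ∧ P ≠ Z) (by
      intro h0
      have h1 := (hab P).2.1
      rw [← H.card_suborbit_one P] at h1
      push_cast at h1
      rw [h0, zero_add] at h1
      have := Int.le_of_dvd one_pos ⟨b, h1⟩
      omega)
    exact ⟨Q, pairType_eq_one.2 ⟨hQ.2, hQ.1⟩⟩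
  · obtain ⟨Q, hQ⟩ := exists_of_ne (fun Z => normInvariant P Z = 0) (by
      intro h0
      have h1 := (hab P).1
      rw [h0, mul_zero] at h1
      exact mul_ne_zero hq0 ha h1.symm)
    exact ⟨Q, H.pairType_eq_two.2 hQ⟩
  · have hne := H.frob.card_norm_ne
    obtain ⟨c, hc⟩ := card_pos.1 (by
      rw [hne]
      exact Nat.mul_pos (by omega) (by omega) :
        0 < #{a : F | a * σ a ≠ 0 ∧ a * σ a ≠ 1})
    obtain ⟨hc0, hc1⟩ := (mem_filter.1 hc).2
    obtain ⟨Q, hQ⟩ := exists_of_ne (fun Z => normInvariant P Z = c * σ c) (by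
      rw [(hab P).2.2 _ (H.frob.apply_mul_self c) hc0 hc1]
      exact mul_ne_zero hq0 ha)
    exact ⟨Q, H.pairType_eq_three.2 (by rw [hQ]; exact ⟨hc0, hc1⟩)⟩

theorem IsUnitary.card_degree_one (H : IsUnitary q h) (hn : 3 ≤ Module.finrank F V)
    (P Q : NonsingularPoint h) : #{Z | pairType P Z = 1} = #{Z | pairType Q Z = 1} := by
  obtain ⟨a, b, -, hab⟩ := H.exists_valencies hn
  have h1 := (hab P).2.1.trans (hab Q).2.1.symm
  rw [← H.card_suborbit_one P, ← H.card_suborbit_one Q] at h1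
  push_cast at h1
  simp only [pairType_eq_one, and_comm (a := _ ≠ _)]
  exact_mod_cast add_right_cancel h1

/-- This is the constancy of μ for the tangent relation: the count does not depend on which
invariant other than 1 the pair has. -/
theorem IsUnitary.card_common_type_one (H : IsUnitary q h) (hn : 3 ≤ Module.finrank F V)
    {P Q P' Q' : NonsingularPoint h} (hPQ : normInvariant P Q ≠ 1)
    (hPQ' : normInvariant P' Q' ≠ 1) :
    #{Z | pairType P Z = 1 ∧ pairType Q Z = 1}
      = #{Z | pairType P' Z = 1 ∧ pairType Q' Z = 1} := by
  have key : ∀ {P Q : NonsingularPoint h}, normInvariant P Q ≠ 1 →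
      (univ.filter fun Z => pairType P Z = 1 ∧ pairType Q Z = 1)
        = univ.filter fun Z => normInvariant P Z = 1 ∧ normInvariant Q Z = 1 := by
    intro P Q hPQ
    ext Z
    simp only [mem_filter, mem_univ, true_and, pairType_eq_one]
    constructor
    · exact fun hZ => ⟨hZ.1.2, hZ.2.2⟩
    · rintro ⟨h1, h2⟩
      refine ⟨⟨?_, h1⟩, ?_, h2⟩
      · rintro rfl
        exact hPQ (by rw [H.normInvariant_comm, h2])
      · rintro rfl
        exact hPQ h1
  obtain ⟨d, hd⟩ : ∃ d, Module.finrank F V = d + 2 := ⟨Module.finrank F V - 2, by omega⟩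
  rw [key hPQ, key hPQ']
  exact card_eq_card_of_mul (by have := H.frob.one_lt; omega) (H.card_common_one hd hPQ)
    (H.card_common_one hd hPQ')

theorem IsUnitary.card_common_type_two_ne (H : IsUnitary q h) (hn : 3 ≤ Module.finrank F V)
    {P Q P' Q' : NonsingularPoint h} (hPQ : pairType P Q = 1) (hPQ' : pairType P' Q' = 3) :
    #{Z | pairType P Z = 2 ∧ pairType Q Z = 2}
      ≠ #{Z | pairType P' Z = 2 ∧ pairType Q' Z = 2} := by
  obtain ⟨d, hd⟩ : ∃ d, Module.finrank F V = d + 3 := ⟨Module.finrank F V - 3, by omega⟩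
  simp only [H.pairType_eq_two]
  intro h0
  have h1 := H.card_common_zero_of_tangent hd (pairType_eq_one.1 hPQ).2 (pairType_eq_one.1 hPQ).1
  have h2 := H.card_common_zero_of_ne (d := d + 1) hd (H.pairType_eq_three.1 hPQ').2
  rw [h0, h2] at h1
  have hq1 := H.frob.one_lt
  have hpow : (-(q : ℤ)) ^ d ≠ 0 := pow_ne_zero _ (neg_ne_zero.2 (by positivity))
  -- The difference of the two counts, both multiplied by q (q + 1).
  have : (-(q : ℤ)) ^ d * (q * (q + 1)) = 0 := by linear_combination h1
  exact mul_ne_zero hpow (by positivity) this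

theorem IsUnitary.card_common_type_three_ne (H : IsUnitary q h) (hn : 3 ≤ Module.finrank F V)
    (hq : 3 ≤ q)
    {P Q P' Q' : NonsingularPoint h} (hPQ : pairType P Q = 1) (hPQ' : pairType P' Q' = 2) :
    #{Z | pairType P Z = 3 ∧ pairType Q Z = 3}
      ≠ #{Z | pairType P' Z = 3 ∧ pairType Q' Z = 3} := by
  obtain ⟨d, hd⟩ : ∃ d, Module.finrank F V = d + 3 := ⟨Module.finrank F V - 3, by omega⟩
  simp only [H.pairType_eq_three]
  intro h0
  have h1 := H.card_common_other_of_tangent hd (pairType_eq_one.1 hPQ).2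
    (pairType_eq_one.1 hPQ).1
  have h2 := H.card_common_other_of_zero (d := d + 1) hd (H.pairType_eq_two.1 hPQ')
  rw [h0, h2] at h1
  have hpow : (-(q : ℤ)) ^ d ≠ 0 := pow_ne_zero _ (neg_ne_zero.2 (by positivity))
  have hq2 : (q : ℤ) - 2 ≠ 0 := by omega
  have : ((q : ℤ) - 2) * ((-(q : ℤ)) ^ d * (q * (q + 1) * (q + 2))) = 0 := by
    linear_combination -h1
  exact mul_ne_zero hq2 (mul_ne_zero hpow (by positivity)) this

end Types

/-! ### Strong regularity transported along a bijection -/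

section Transport

variable {Ω X : Type*} [Fintype X]

theorem card_filter_equiv (e : Ω ≃ X) (p : X → Prop) [DecidablePred p] :
    Nat.card {z : Ω // p (e z)} = #{Z | p Z} := by
  rw [Nat.card_congr (e.subtypeEquiv (q := p) fun _ => Iff.rfl), Nat.card_eq_fintype_card,
    Fintype.card_subtype]

theorem card_commonNeighbors (e : Ω ≃ X) {Γ : SimpleGraph Ω} {R : X → X → Prop} [DecidableRel R]
    (hΓ : ∀ a b, Γ.Adj a b ↔ R (e a) (e b)) (a b : Ω) [Fintype (Γ.commonNeighbors a b)] :
    Fintype.card (Γ.commonNeighbors a b) = #{Z | R (e a) Z ∧ R (e b) Z} := by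
  rw [← Nat.card_eq_fintype_card, ← card_filter_equiv e]
  refine Nat.card_congr (Equiv.subtypeEquivRight fun z => ?_)
  rw [SimpleGraph.mem_commonNeighbors, hΓ, hΓ]

variable [Fintype Ω]

theorem IsStronglyRegular.card_common_eq (e : Ω ≃ X) {Γ : SimpleGraph Ω} {R : X → X → Prop} [DecidableRel R]
    (hΓ : ∀ a b, Γ.Adj a b ↔ R (e a) (e b)) (hs : IsStronglyRegular Γ) {P Q P' Q' : X}
    (hPQ : P ≠ Q) (hR : ¬ R P Q) (hPQ' : P' ≠ Q') (hR' : ¬ R P' Q') :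
    #{Z | R P Z ∧ R Q Z} = #{Z | R P' Z ∧ R Q' Z} := by
  obtain ⟨v, k, l, m, hs⟩ := hs
  have key : ∀ {P Q : X}, P ≠ Q → ¬ R P Q → #{Z | R P Z ∧ R Q Z} = m := by
    intro P Q hPQ hR
    have h1 := hs.of_not_adj (fun h0 => hPQ (e.symm.injective h0) : e.symm P ≠ e.symm Q)
      (by rw [hΓ]; simpa using hR)
    rw [card_commonNeighbors e hΓ] at h1
    simpa using h1
  rw [key hPQ hR, key hPQ' hR']

theorem isStronglyRegular_of_card_eq (e : Ω ≃ X) {Γ : SimpleGraph Ω} {R : X → X → Prop} [DecidableRel R]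
    (hΓ : ∀ a b, Γ.Adj a b ↔ R (e a) (e b))
    (hdeg : ∀ P Q, #{Z | R P Z} = #{Z | R Q Z})
    (hadj : ∀ P Q P' Q', R P Q → R P' Q' → #{Z | R P Z ∧ R Q Z} = #{Z | R P' Z ∧ R Q' Z})
    (hnadj : ∀ P Q P' Q', P ≠ Q → ¬ R P Q → P' ≠ Q' → ¬ R P' Q' →
      #{Z | R P Z ∧ R Q Z} = #{Z | R P' Z ∧ R Q' Z}) : IsStronglyRegular Γ := by
  have hk : ∃ k, ∀ P, #{Z | R P Z} = k := by
    rcases isEmpty_or_nonempty X with hX | ⟨⟨P⟩⟩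
    · exact ⟨0, fun P => (hX.false P).elim⟩
    · exact ⟨_, fun Q => hdeg Q P⟩
  have hl : ∃ l, ∀ P Q, R P Q → #{Z | R P Z ∧ R Q Z} = l := by
    by_cases hR : ∃ P Q, R P Q
    · obtain ⟨P, Q, hPQ⟩ := hR
      exact ⟨_, fun P' Q' h' => hadj P' Q' P Q h' hPQ⟩
    · push Not at hR
      -- With no related pairs the parameter is arbitrary; 0 is a default.
      exact ⟨0, fun P Q hPQ => absurd hPQ (hR P Q)⟩
  have hm : ∃ m, ∀ P Q, P ≠ Q → ¬ R P Q → #{Z | R P Z ∧ R Q Z} = m := by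
    by_cases hR : ∃ P Q, P ≠ Q ∧ ¬ R P Q
    · obtain ⟨P, Q, hPQ, hR⟩ := hR
      exact ⟨_, fun P' Q' h' hR' => hnadj P' Q' P Q h' hR' hPQ hR⟩
    · push Not at hR
      exact ⟨0, fun P Q hPQ hn => absurd (hR P Q hPQ) hn⟩
  obtain ⟨k, hk⟩ := hk
  obtain ⟨l, hl⟩ := hl
  obtain ⟨m, hm⟩ := hm
  refine ⟨_, k, l, m, rfl, fun a => ?_, fun a b hab => ?_, fun a b hab hn => ?_⟩
  · rw [← hk (e a), ← card_filter_equiv e, ← SimpleGraph.card_neighborSet_eq_degree,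
      ← Nat.card_eq_fintype_card]
    refine Nat.card_congr (Equiv.subtypeEquivRight fun z => ?_)
    rw [SimpleGraph.mem_neighborSet, hΓ]
  · rw [card_commonNeighbors e hΓ]
    exact hl _ _ ((hΓ a b).1 hab)
  · rw [card_commonNeighbors e hΓ]
    exact hm _ _ (fun h0 => hab (e.injective h0)) (fun h0 => hn ((hΓ a b).2 h0))

end Transport

/-! ### Suborbits of normal subgroups, and invariants separating orbitals -/

section Orbits

variable {G Ω : Type*} [Group G] [MulAction G Ω]

/-- Suborbits of a normal subgroup are permuted by the whole group. -/
theorem natCard_suborbit_smul (N : Subgroup G) [hN : N.Normal] (g : G) (x y : Ω) :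
    Nat.card {z : Ω // ∃ s : N, s • x = x ∧ s • y = z}
      = Nat.card {z : Ω // ∃ s : N, s • g • x = g • x ∧ s • g • y = z} := by
  refine Nat.card_congr ((MulAction.toPerm g).subtypeEquiv fun z => ?_)
  constructor
  · rintro ⟨s, hx, hy⟩
    refine ⟨⟨g * s * g⁻¹, hN.conj_mem s s.2 g⟩, ?_, ?_⟩
    · rw [Subgroup.smul_def] at hx ⊢
      rw [mul_smul, mul_smul, inv_smul_smul, hx]
    · rw [Subgroup.smul_def] at hy ⊢
      rw [mul_smul, mul_smul, inv_smul_smul, hy]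
      rfl
  · rintro ⟨s, hx, hy⟩
    refine ⟨⟨g⁻¹ * s * g⁻¹⁻¹, hN.conj_mem s s.2 g⁻¹⟩, ?_, ?_⟩
    · rw [Subgroup.smul_def] at hx ⊢
      rw [mul_smul, mul_smul, inv_inv, hx, inv_smul_smul]
    · rw [Subgroup.smul_def] at hy ⊢
      rw [mul_smul, mul_smul, inv_inv, hy]
      exact inv_smul_smul g z

/-- An invariant of pairs taking as many values as there are orbits separates the orbits. -/
theorem mem_orbit_iff_of_permRank {n : ℕ} [NeZero n] (hrank : permRank G Ω = n)
    (t : Ω × Ω → Fin n)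
    (ht : ∀ (g : G) p, t (g • p) = t p) (hsurj : Function.Surjective t) (p p' : Ω × Ω) :
    p' ∈ MulAction.orbit G p ↔ t p' = t p := by
  constructor
  · rintro ⟨g, rfl⟩
    exact ht g p
  · intro hpp
    let f : MulAction.orbitRel.Quotient G (Ω × Ω) → Fin n := Quotient.lift t (by
      rintro a b ⟨g, rfl⟩
      exact ht g b)
    have hf : Function.Surjective f := fun i => by
      obtain ⟨p, hp⟩ := hsurj i
      exact ⟨Quotient.mk _ p, hp⟩
    unfold permRank at hrank
    -- `Nat.card` is 0 on infinite types, so a nonzero rank gives finiteness; a surjection between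
    -- finite sets of equal size is then injective.
    have : Finite (MulAction.orbitRel.Quotient G (Ω × Ω)) :=
      Nat.finite_of_card_ne_zero (by rw [hrank]; exact NeZero.ne n)
    have hbij := (Nat.bijective_iff_surjective_and_card f).2 ⟨hf, by rw [hrank, Nat.card_fin]⟩
    have h1 : (Quotient.mk _ p' : MulAction.orbitRel.Quotient G (Ω × Ω)) = Quotient.mk _ p :=
      hbij.1 hpp
    exact MulAction.orbitRel_apply.1 (Quotient.exact h1)

end Orbits

/-! ### Identification of the permuted set with the nonsingular points -/

section Identification

variable {F V : Type*} [Field F] [AddCommGroup V] [Module F V] {σ : F →+* F}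
variable {h : V →ₛₗ[σ] V →ₗ[F] F}

/-- Scalar transformations fix all points. -/
theorem smul_eq_of_mem_scalars {g : SU h} (hg : g ∈ scalars h) (P : NonsingularPoint h) :
    g • P = P := by
  obtain ⟨c, hc⟩ := hg
  obtain ⟨v, hv, hP⟩ := P.2
  have hc0 : c ≠ 0 := by
    rintro rfl
    have : g.1 v = g.1 0 := by rw [hc, zero_smul, map_zero]
    rw [g.1.injective this] at hv
    simp at hv
  exact smul_eq_of_apply_eq hP hP hc0 (hc v)

theorem smul_eq_of_mk_eq {g g' : SU h} (hg : (QuotientGroup.mk g : PSU h) = QuotientGroup.mk g')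
    (P : NonsingularPoint h) : g • P = g' • P := by
  have h1 := smul_eq_of_mem_scalars (QuotientGroup.eq.1 hg) P
  rw [mul_smul, inv_smul_eq_iff] at h1
  exact h1.symm

theorem mk_mem_N1_iff {g : SU h} {P : NonsingularPoint h} :
    (QuotientGroup.mk g : PSU h) ∈ N1 h P ↔ g • P = P := by
  constructor
  · rintro ⟨g', hg', heq⟩
    rw [← smul_eq_of_mk_eq heq]
    exact hg'
  · intro hg
    exact ⟨g, hg, rfl⟩

/-- A transitive action of `PSU` with point stabiliser `N1` is the action on nonsingular points. -/
theorem exists_equiv_nonsingularPoint {S Ω : Type*} [Group S] [MulAction S Ω]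
    [MulAction.IsPretransitive S Ω] (φ : S ≃* PSU h) (α : Ω) (P : NonsingularPoint h)
    (hP : ∀ Q : NonsingularPoint h, ∃ g : SU h, g • P = Q)
    (hstab : ∀ s : S, s • α = α ↔ φ s ∈ N1 h P) :
    ∃ e : Ω ≃ NonsingularPoint h, e α = P ∧
      ∀ (s : S) (g : SU h), φ s = (QuotientGroup.mk g : PSU h) →
        ∀ ω : Ω, e (s • ω) = g • e ω := by
  have key : ∀ (s s' : S) (g g' : SU h), φ s = (QuotientGroup.mk g : PSU h) →
      φ s' = (QuotientGroup.mk g' : PSU h) → (s • α = s' • α ↔ g • P = g' • P) := by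
    intro s s' g g' hg hg'
    rw [← inv_smul_eq_iff, ← mul_smul, hstab, map_mul, map_inv, hg, hg', ← QuotientGroup.mk_inv,
      ← QuotientGroup.mk_mul, mk_mem_N1_iff, mul_smul, inv_smul_eq_iff]
  -- The map sends s • α to g • P for any lift g of φ s. One direction of `key` makes it well
  -- defined, the other makes it injective.
  have hex : ∀ ω : Ω, ∃ Q : NonsingularPoint h, ∀ (s : S) (g : SU h), s • α = ω →
      φ s = (QuotientGroup.mk g : PSU h) → Q = g • P := by
    intro ω
    obtain ⟨s, rfl⟩ := MulAction.exists_smul_eq S α ω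
    obtain ⟨g, hg⟩ := QuotientGroup.mk_surjective (φ s)
    exact ⟨g • P, fun s' g' hs' hg' => (key s s' g g' hg.symm hg').1 hs'.symm⟩
  choose e he using hex
  have he' : ∀ (s : S) (g : SU h), φ s = (QuotientGroup.mk g : PSU h) → e (s • α) = g • P :=
    fun s g hg => he _ s g rfl hg
  have hbij : Function.Bijective e := by
    constructor
    · intro ω ω' hωω
      obtain ⟨s, rfl⟩ := MulAction.exists_smul_eq S α ω
      obtain ⟨s', rfl⟩ := MulAction.exists_smul_eq S α ω'
      obtain ⟨g, hg⟩ := QuotientGroup.mk_surjective (φ s)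
      obtain ⟨g', hg'⟩ := QuotientGroup.mk_surjective (φ s')
      rw [he' s g hg.symm, he' s' g' hg'.symm] at hωω
      exact (key s s' g g' hg.symm hg'.symm).2 hωω
    · intro Q
      obtain ⟨g, rfl⟩ := hP Q
      exact ⟨φ.symm (QuotientGroup.mk g) • α, he' _ g (φ.apply_symm_apply _)⟩
  refine ⟨Equiv.ofBijective e hbij, ?_, fun s g hg ω => ?_⟩
  · have := he' 1 1 (by rw [map_one]; rfl)
    rwa [one_smul, one_smul] at this
  · obtain ⟨s', rfl⟩ := MulAction.exists_smul_eq S α ω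
    obtain ⟨g', hg'⟩ := QuotientGroup.mk_surjective (φ s')
    rw [Equiv.ofBijective_apply, Equiv.ofBijective_apply, he' s' g' hg'.symm, ← mul_smul,
      ← mul_smul]
    exact he' _ _ (by rw [map_mul, hg, ← hg', QuotientGroup.mk_mul])

end Identification

/-! ### Orbitals of the primitive group and the uniqueness of the tangent graph -/

section Main

variable {F V : Type*} [Field F] [AddCommGroup V] [Module F V] {σ : F →+* F}
variable {h : V →ₛₗ[σ] V →ₗ[F] F} {q : ℕ}
variable [Fintype F] [Fintype V] [FiniteDimensional F V] [Fintype (NonsingularPoint h)]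
variable {G Ω : Type*} [Group G] [MulAction G Ω]

instance socle_normal (G : Type*) [Group G] : (socle G).Normal :=
  Subgroup.sSup_normal _ fun _ hN => hN.1

/-- A socle isomorphic to `PSU` is transitive in a faithful primitive action. -/
theorem IsUnitary.isPretransitive_socle (H : IsUnitary q h) (hq : q = 3 ∨ q = 4)
    (hn : 3 ≤ Module.finrank F V) [FaithfulSMul G Ω] [MulAction.IsPreprimitive G Ω]
    (φ : socle G ≃* PSU h) (P : NonsingularPoint h) :
    MulAction.IsPretransitive (socle G) Ω := by
  apply MulAction.IsQuasiPreprimitive.isPretransitive_of_normal (G := G)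
  intro hfix
  have hone : ∀ s : socle G, s = 1 := by
    intro s
    apply Subtype.ext
    apply FaithfulSMul.eq_of_smul_eq_smul (α := Ω)
    intro ω
    have : ω ∈ MulAction.fixedPoints (socle G) Ω := by rw [hfix]; trivial
    rw [Subgroup.coe_one, one_smul]
    exact this s
  -- A socle acting trivially would be trivial by faithfulness, and PSU with it; yet SU moves P to a
  -- different point.
  obtain ⟨Q, hQ⟩ := H.exists_pairType_eq hn (by omega) P 1
  obtain ⟨g, hg⟩ := H.exists_smul_eq hq hn P Q
  have h1 : (QuotientGroup.mk g : PSU h) = QuotientGroup.mk 1 := by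
    rw [← φ.apply_symm_apply (QuotientGroup.mk g : PSU h), hone (φ.symm _), map_one]
    rfl
  have h2 := smul_eq_of_mk_eq h1 P
  rw [hg, one_smul] at h2
  exact (pairType_eq_one.1 hQ).1 h2.symm

/-- Any group having `PSU` as a normal subgroup preserves the types of pairs of points. -/
theorem IsUnitary.pairType_equiv_smul (H : IsUnitary q h) (hq : q = 3 ∨ q = 4)
    (hn : 3 ≤ Module.finrank F V) {N : Subgroup G} [N.Normal] (φ : N ≃* PSU h)
    (e : Ω ≃ NonsingularPoint h)
    (he : ∀ (s : N) (g : SU h), φ s = (QuotientGroup.mk g : PSU h) →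
        ∀ ω : Ω, e (s • ω) = g • e ω) (g : G) (x y : Ω) :
    pairType (e (g • x)) (e (g • y)) = pairType (e x) (e y) := by
  by_cases hxy : x = y
  · subst hxy
    rw [pairType_eq_zero.2 rfl, pairType_eq_zero.2 rfl]
  -- The suborbit of the normal subgroup through a pair is a level set of the invariant. Conjugation
  -- by g preserves its size, and the size determines the type.
  · have key : ∀ x y : Ω, x ≠ y → Nat.card {z : Ω // ∃ s : N, s • x = x ∧ s • y = z}
        = #{Z | normInvariant (e x) Z = normInvariant (e x) (e y) ∧ e x ≠ Z} := by
      intro x y hxy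
      rw [← card_filter_equiv e]
      refine Nat.card_congr (Equiv.subtypeEquivRight fun z => ?_)
      rw [← H.exists_smul_iff hq hn (e.injective.ne hxy)]
      constructor
      · rintro ⟨s, hx, rfl⟩
        obtain ⟨g, hg⟩ := QuotientGroup.mk_surjective (φ s)
        exact ⟨g, by rw [← he s g hg.symm, hx], (he s g hg.symm y).symm⟩
      · rintro ⟨g, hx, hy⟩
        have hg := φ.apply_symm_apply (QuotientGroup.mk g)
        exact ⟨φ.symm (QuotientGroup.mk g), e.injective (by rw [he _ g hg, hx]),
          e.injective (by rw [he _ g hg, hy])⟩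
    have hgxy : g • x ≠ g • y := fun h0 => hxy (smul_left_cancel g h0)
    refine (H.pairType_eq_of_card_eq hn (e.injective.ne hxy) (e.injective.ne hgxy) ?_).symm
    rw [← key x y hxy, ← key _ _ hgxy, natCard_suborbit_smul N g]

/-- The relation "on a tangent" is strongly regular. -/
theorem IsUnitary.isStronglyRegular_tangent [Fintype Ω] (H : IsUnitary q h) (hq : q = 3 ∨ q = 4)
    (hn : 3 ≤ Module.finrank F V) (e : Ω ≃ NonsingularPoint h) {Γ : SimpleGraph Ω}
    (hΓ : ∀ a b, Γ.Adj a b ↔ pairType (e a) (e b) = 1) : IsStronglyRegular Γ := by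
  refine isStronglyRegular_of_card_eq e (R := fun P Q => pairType P Q = 1) hΓ
    (fun P Q => H.card_degree_one hn P Q) ?_ ?_
  · intro P Q P' Q' hPQ hPQ'
    rw [pairType_eq_one] at hPQ hPQ'
    -- Tangent pairs form a single SU-orbit, so λ is constant without being computed.
    obtain ⟨g, rfl, rfl⟩ := H.exists_smul_pair_eq hq hn hPQ.1 hPQ'.1 (hPQ.2.trans hPQ'.2.symm)
    refine card_equiv (MulAction.toPerm g) fun Z => ?_
    simp [H.pairType_smul]
  · intro P Q P' Q' hPQ hR hPQ' hR'
    refine H.card_common_type_one hn ?_ ?_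
    · exact fun h0 => hR (pairType_eq_one.2 ⟨hPQ, h0⟩)
    · exact fun h0 => hR' (pairType_eq_one.2 ⟨hPQ', h0⟩)

/-- The other relations are not strongly regular. -/
theorem IsUnitary.eq_one_of_isStronglyRegular [Fintype Ω] (H : IsUnitary q h) (hq : 3 ≤ q)
    (hn : 3 ≤ Module.finrank F V) (P : NonsingularPoint h) (e : Ω ≃ NonsingularPoint h)
    {Γ : SimpleGraph Ω} {i : Fin 4} (hi : i ≠ 0)
    (hΓ : ∀ a b, Γ.Adj a b ↔ pairType (e a) (e b) = i) (hs : IsStronglyRegular Γ) : i = 1 := by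
  have hne : ∀ {P Q : NonsingularPoint h} {j : Fin 4}, pairType P Q = j → j ≠ 0 → P ≠ Q :=
    fun h1 h2 h3 => h2 (h1.symm.trans (pairType_eq_zero.2 h3))
  obtain ⟨Q₁, h₁⟩ := H.exists_pairType_eq hn hq P 1
  obtain ⟨Q₂, h₂⟩ := H.exists_pairType_eq hn hq P 2
  obtain ⟨Q₃, h₃⟩ := H.exists_pairType_eq hn hq P 3
  fin_cases i
  · exact absurd rfl hi
  · rfl
  -- Tangent and other pairs are both non-adjacent here, but have different numbers of common
  -- neighbours.
  · refine absurd (hs.card_common_eq e (R := fun P Q => pairType P Q = 2) hΓ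
      (hne h₁ (by decide)) ?_ (hne h₃ (by decide)) ?_) (H.card_common_type_two_ne hn h₁ h₃)
    · rw [h₁]; decide
    · rw [h₃]; decide
  · refine absurd (hs.card_common_eq e (R := fun P Q => pairType P Q = 3) hΓ
      (hne h₁ (by decide)) ?_ (hne h₂ (by decide)) ?_) (H.card_common_type_three_ne hn hq h₁ h₂)
    · rw [h₁]; decide
    · rw [h₂]; decide

/-- If the types of pairs are the orbitals, then `NU` is the only strongly regular orbital
graph. -/
theorem IsUnitary.orbitalGraph_iff [Fintype Ω] (H : IsUnitary q h) (hq : q = 3 ∨ q = 4)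
    (hn : 3 ≤ Module.finrank F V) (P : NonsingularPoint h) (e : Ω ≃ NonsingularPoint h)
    (horb : ∀ x y a b : Ω, (a, b) ∈ MulAction.orbit G (x, y) ↔
      pairType (e a) (e b) = pairType (e x) (e y)) (Γ : SimpleGraph Ω) :
    (IsOrbitalGraph G Γ ∧ IsStronglyRegular Γ) ↔ Γ = (NU h).comap e := by
  have hadj : ∀ x y : Ω, x ≠ y → ∀ a b,
      (orbitalGraph (MulAction.orbit G (x, y))).Adj a b ↔
        pairType (e a) (e b) = pairType (e x) (e y) := by
    intro x y hxy a b
    -- Types are symmetric, so each orbital is its own reverse and the union with the reverse adds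
    -- nothing.
    rw [orbitalGraph, SimpleGraph.fromRel_adj, horb, horb, H.pairType_comm (e b), or_self,
      and_iff_right_iff_imp]
    rintro h1 rfl
    rw [pairType_eq_zero.2 rfl, eq_comm, pairType_eq_zero] at h1
    exact hxy (e.injective h1)
  have hNU : ∀ a b, ((NU h).comap e).Adj a b ↔ pairType (e a) (e b) = 1 := by
    intro a b
    rw [SimpleGraph.comap_adj, H.NU_adj_iff, pairType_eq_one]
  constructor
  · rintro ⟨⟨x, y, hxy, rfl⟩, hs⟩
    have h1 := H.eq_one_of_isStronglyRegular (by omega) hn P e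
      (fun h0 => hxy (e.injective (pairType_eq_zero.1 h0))) (hadj x y hxy) hs
    ext a b
    rw [hadj x y hxy, hNU, h1]
  · rintro rfl
    refine ⟨?_, H.isStronglyRegular_tangent hq hn e hNU⟩
    obtain ⟨Q, hQ⟩ := H.exists_pairType_eq hn (by omega) P 1
    have hne : e.symm P ≠ e.symm Q := e.symm.injective.ne (pairType_eq_one.1 hQ).1
    refine ⟨e.symm P, e.symm Q, hne, ?_⟩
    ext a b
    rw [hadj _ _ hne, hNU, e.apply_symm_apply, e.apply_symm_apply, hQ]

end Main

end UnitarySRG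

open UnitarySRG in
/-- `F` is the field with `q²` elements, `σ` its `q`-power map, `h` a nondegenerate hermitian form
on the `n`-dimensional space `V`; `G` is a primitive permutation group of rank four on `Ω` whose
socle is `PSU_n(q)`, where the stabiliser of `α` in the socle is that of a nonsingular `1`-space
`P`. After the identification of `Ω` with the nonsingular `1`-spaces, as sets acted on by the
socle, the strongly regular graphs among the non-diagonal orbital graphs of `G` are
`NU_n(q)` alone. -/
theorem proposition3p4 {n q : ℕ} (hn : 3 ≤ n) (hq : q = 3 ∨ q = 4)
    {F V : Type*} [Field F] [AddCommGroup V] [Module F V]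
    (hF : Nat.card F = q ^ 2) (hV : Module.finrank F V = n)
    {σ : F →+* F} (hσ : ∀ a : F, σ a = a ^ q)
    (h : V →ₛₗ[σ] V →ₗ[F] F) (hsymm : h.IsSymm) (hnd : h.Nondegenerate)
    {G Ω : Type*} [Group G] [Fintype Ω] [MulAction G Ω] [FaithfulSMul G Ω]
    [MulAction.IsPreprimitive G Ω] (hrank : permRank G Ω = 4)
    (φ : socle G ≃* PSU h) (α : Ω) (P : NonsingularPoint h)
    (hstab : ((MulAction.stabilizer G α).subgroupOf (socle G)).map φ.toMonoidHom = N1 h P) :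
    ∃ e : Ω ≃ NonsingularPoint h,
      e α = P ∧
      (∀ (s : socle G) (g : SU h), φ s = (QuotientGroup.mk g : PSU h) →
        ∀ ω : Ω, e (s • ω) = g • e ω) ∧
      ∀ Γ : SimpleGraph Ω,
        (IsOrbitalGraph G Γ ∧ IsStronglyRegular Γ) ↔ Γ = (NU h).comap e := by
  have : Finite F := Nat.finite_of_card_ne_zero (by rw [hF]; rcases hq with rfl | rfl <;> norm_num)
  have : FiniteDimensional F V := Module.finite_of_finrank_pos (by omega)
  have : Finite V := Module.finite_of_finite F
  have : Finite (NonsingularPoint h) := inferInstanceAs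
    (Finite {P : Submodule F V // ∃ v : V, h v v ≠ 0 ∧ P = F ∙ v})
  have := Fintype.ofFinite F
  have := Fintype.ofFinite V
  have := Fintype.ofFinite (NonsingularPoint h)
  have H : IsUnitary q h := ⟨⟨by omega, hF, hσ⟩, hsymm, hnd⟩
  rw [← hV] at hn
  have := H.isPretransitive_socle (G := G) (Ω := Ω) hq hn φ P
  obtain ⟨e, heα, he⟩ := exists_equiv_nonsingularPoint φ α P (H.exists_smul_eq hq hn P) (by
    intro s
    rw [← hstab, Subgroup.mem_map]
    constructor
    · exact fun hs => ⟨s, hs, rfl⟩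
    · rintro ⟨s', hs', heq⟩
      rw [← φ.injective heq]
      exact hs')
  refine ⟨e, heα, he, H.orbitalGraph_iff hq hn P e fun x y a b => ?_⟩
  -- The type is a G-invariant of pairs taking all four values, as many as there are orbitals.
  refine mem_orbit_iff_of_permRank hrank (fun p => pairType (e p.1) (e p.2))
    (fun g p => H.pairType_equiv_smul hq hn φ e he g p.1 p.2) (fun i => ?_) (x, y) (a, b)
  obtain ⟨Q, hQ⟩ := H.exists_pairType_eq hn (by omega) P i
  exact ⟨(e.symm P, e.symm Q), by simpa using hQ⟩
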